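/- Let $\mathcal{X}$ be a measurable space, let $\mathcal{Y}=\{-1,1\}$, and let $\mathcal{H}\subseteq\mathcal{Y}^{\mathcal{X}}$ be a class of measurable hypotheses. For a probability measure $\mathcal{D}$ on $\mathcal{X}\times\mathcal{Y}$ put $\mathcal{L}_{\mathcal{D}}(h)=\mathbb{P}_{(x,y)\sim\mathcal{D}}[h(x)\neq y]$. A learner $\mathcal{A}$, mapping finite sequences in $\mathcal{X}\times\mathcal{Y}$ to hypotheses, is an empirical risk minimization (ERM) learner for $\mathcal{H}$ if for every finite training sequence $S$ the hypothesis $\mathcal{A}(S)$ belongs to $\mathcal{H}$ and minimizes over $\mathcal{H}$ the fraction of the examples of $S$ that are misclassified. It is measurable if, for each $n$, the map $(S,x)\mapsto\mathcal{A}(S)(x)$ is measurable on $(\mathcal{X}\times\mathcal{Y})^n\times\mathcal{X}$. For finite sequences $S,T$ in $\mathcal{X}\times\mathcal{Y}$ with $|S|=3^k$, define a finite family $\mathcal{S}(S;T)$ of sequences (with repetitions) recursively; $\sqcup$ denotes concatenation. If $k<6$, then $\mathcal{S}(S;T)$ consists of the single sequence $S\sqcup T$. If $k\ge 6$, cut $S$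 into 27 consecutive blocks $S_1,\dots,S_{27}$ of length $3^{k-3}$; let $S_{i,\sqcup}$ be the first $3^{k-6}$ elements of $S_i$ and $S_{i,\sqcap}$ the remaining ones; then $\mathcal{S}(S;T)$ is the union, with repetitions, of the families $\mathcal{S}(S_{i,\sqcup};\,S_{i,\sqcap}\sqcup T)$ for $i=1,\dots,27$. Let $\mathcal{A}(S;T)=(\mathcal{A}(S'))_{S'\in\mathcal{S}(S;T)}$, and for $\alpha\in[0,1]$ let $\mathcal{L}^{\alpha}_{\mathcal{D}}(\mathcal{A}(S;T))$ be the probability over $(x,y)\sim\mathcal{D}$ that at least an $\alpha$-fraction of the hypotheses $h$ in the family $\mathcal{A}(S;T)$ satisfy $h(x)\neq y$. **Lemma.** There is a universal constant $c\ge 1$ such that the following holds. Let $\mathcal{H}$ be a class of measurable hypotheses of finite VC dimension $d$ on a measurable space $\mathcal{X}$, let $\mathcal{A}$ be a measurable ERM learner for $\mathcal{H}$, and let $\mathcal{D}$ be a probability measure on $\mathcal{X}\times\mathcal{Y}$ for which some $h^\star\in\mathcal{H}$ minimizes $\mathcal{L}_{\mathcal{D}}$ over $\mathcal{H}$; put $\tau=\mathcal{L}_{\mathcal{D}}(h^\star)$.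 Let $0<\delta<1$ and $m=3^k$ with $k\ge 6$. Then, with probability at least $1-\delta$ over a training sequence $\mathbf{S}\sim\mathcal{D}^m$, $$\mathcal{L}^{10/243}_{\mathcal{D}}\big(\mathcal{A}(\mathbf{S};\emptyset)\big)\;\le\; c\,\tau+\frac{c\,\big(d+\ln(e/\delta)\big)}{m}.$$ -/

import Mathlib

open MeasureTheory

namespace AgnosticERM

noncomputable section

/-- The label set `{-1, 1}`, as the group of units of `ℤ`. -/
abbrev Label : Type := ℤˣ

/-- Every subset of the label set is measurable. -/
instance : DiscreteMeasurableSpace Label where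
  forall_measurableSet s := by
    refine ⟨Units.val '' s, trivial, ?_⟩
    exact Set.preimage_image_eq s Units.val_injective

/-- Hypotheses (classifiers) on the domain `X`. -/
abbrev Hypothesis (X : Type*) : Type _ := X → Label

/-- Labeled examples. -/
abbrev Example (X : Type*) : Type _ := X × Label

/-- A learner maps finite training sequences to hypotheses. -/
abbrev Learner (X : Type*) : Type _ := List (Example X) → Hypothesis X

/-- `H` shatters the finite set `s`: every labeling of `s` is realized by a member of `H`. -/
def Shatters {X : Type*} (H : Set (Hypothesis X)) (s : Finset X) : Prop :=
  ∀ f : X → Label, ∃ h ∈ H, ∀ x ∈ s, h x = f x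

/-- The VC dimension: the supremum of the cardinalities of the shattered finite sets. -/
def vcDim {X : Type*} (H : Set (Hypothesis X)) : ℕ∞ :=
  ⨆ (s : Finset X) (_ : Shatters H s), (s.card : ℕ∞)

/-- The true error of `h`: the `D`-probability that `h x ≠ y`. -/
def trueError {X : Type*} [MeasurableSpace X] (D : Measure (Example X)) (h : Hypothesis X) : ℝ :=
  D.real {z | h z.1 ≠ z.2}

/-- The empirical error of `h`: the fraction of the examples of `S` on which `h` errs
(and `0` on the empty sequence). -/
def empiricalError {X : Type*} (S : List (Example X)) (h : Hypothesis X) : ℝ :=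
  (S.countP (fun z => decide (h z.1 ≠ z.2)) : ℝ) / (S.length : ℝ)

/-- `A` is an empirical risk minimization learner for `H`: on each training sequence it outputs a
member of `H` whose empirical error is minimal over `H`. -/
def IsERM {X : Type*} (H : Set (Hypothesis X)) (A : Learner X) : Prop :=
  ∀ S : List (Example X), A S ∈ H ∧ ∀ h ∈ H, empiricalError S (A S) ≤ empiricalError S h

/-- The learner `A` is measurable: for each length `n`, the predicted label `A(S)(x)` is a jointly
measurable function of the training sequence `S` of length `n` and of the point `x`. -/
def IsMeasurableLearner {X : Type*} [MeasurableSpace X] (A : Learner X) : Prop :=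
  ∀ n : ℕ, Measurable (fun p : (Fin n → Example X) × X => A (List.ofFn p.1) p.2)

/-- The `i`-th of the consecutive blocks of length `b` of `S` (counting from `i = 0`). -/
def block {Z : Type*} (S : List Z) (b i : ℕ) : List Z :=
  (S.drop (i * b)).take b

/-- The splitting algorithm, run on sequences `S, T` with `|S| = 3 ^ k`; the result is the family
of all training sequences that its recursive calls return.

If `k ≥ 6` (written `k + 6` in the pattern), `S` is cut into `27` consecutive blocks
`S₁, …, S₂₇` of length `3 ^ (k - 3)`. The first `3 ^ (k - 6)` elements of `Sᵢ` are the new active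
sequence, and the remaining ones are put in front of `T`. If `k < 6`, the only output is `S`
followed by `T`. -/
def splits {Z : Type*} : (k : ℕ) → (S T : List Z) → List (List Z)
  | k + 6, S, T =>
      (List.range 27).flatMap fun i =>
        splits k ((block S (3 ^ (k + 3)) i).take (3 ^ k))
          ((block S (3 ^ (k + 3)) i).drop (3 ^ k) ++ T)
  | _, S, T => [S ++ T]

/-- The family `𝒜(S; T)` (with repetitions) of the outputs of the learner `A` on all training
sequences that the splitting algorithm creates from `S` and `T`, where `|S| = 3 ^ k`. -/
def ermFamily {X : Type*} (A : Learner X) (k : ℕ) (S T : List (Example X)) :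
    List (Hypothesis X) :=
  (splits k S T).map A

/-- The fraction of the hypotheses in the family `F` that err on the example `z`. -/
def avgNe {X : Type*} (F : List (Hypothesis X)) (z : Example X) : ℝ :=
  (F.countP (fun h => decide (h z.1 ≠ z.2)) : ℝ) / (F.length : ℝ)

/-- The probability that at least an `α`-fraction of the hypotheses in `F` err on a new example
drawn from `D`. -/
def fractionError {X : Type*} [MeasurableSpace X] (D : Measure (Example X)) (α : ℝ)
    (F : List (Hypothesis X)) : ℝ :=
  D.real {z | α ≤ avgNe F z}

end

end AgnosticERM

open AgnosticERM

/-! The proof is an induction over the recursion, in steps of six in `k` (`SplitBound.add_six`). The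
invariant bounds the error of the family built from `(s; t)`, with high probability, by `10 ^ 9 * (E
+ d + log (e / δ)) / 3 ^ k`. Here `E` is the number of errors of `hstar` on `s ++ t`. Every training
sequence that occurs is a sub-multiset of `s ++ t`, so an ERM output makes at most `E` errors on it.

In the inductive step let `F j` be the `j`-th subfamily and `R j` the region where at least a
10/243-fraction of it errs. If the average of the 27 subfamilies is at least 10/243 at a point, one
of them is that large there, and the others still sum to at least 10/9 - 1 = 1/9. Hence the total
error is at most nine times the sum over `j ≠ l` of the probability that the point lies in `R j` and
a random member of `F l` errs (`fractionError_flatMap_le`).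

For `j ≠ l`, the region `R j` does not depend on the inactive part `V l` of block `l`, while every
member of `F l` is trained on all of `V l`. Conditionally on the rest, `V l` is a fresh sample of
`26 * 3 ^ k` examples. A relative deviation bound localized to `R j`
(`measureReal_relative_deviation_le`) then gives at most `20 * q * x` plus a term of order `(E + d *
log (1 / x) + log (1 / δ)) / 3 ^ k`, where `q` is the mass of `R j`. The inductive bound controls
`q`, and a tiny fixed `x` shrinks its contribution enough to pay for the union over pairs and for
the factor 729 between consecutive levels.

The deviation bound comes from exponential weights on a sample and a ghost sample. Random swaps of
pairs, together with Sauer-Shelah in the form `card * x ^ d ≤ (1 + x) ^ hits`, bound the mean weight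
by `x ^ (-d)`. Only hits of `R` are counted, so no logarithm of the sample size appears. Averaging
over the family inside the weight avoids a union bound over its members. Finally, a Chernoff bound
replaces `E` by the true error of `hstar`. -/

namespace AgnosticERM

/-! ### Error patterns and the Sauer-Shelah bound -/

open Classical in
/-- The indices at which the sample `w` lies in `R` and `h` errs. -/
noncomputable def errorPattern {X β : Type*} [Fintype β] (R : Set (Example X)) (w : β → Example X)
    (h : Hypothesis X) : Finset β :=
  Finset.univ.filter fun b => w b ∈ R ∧ h (w b).1 ≠ (w b).2

open Classical in
/-- The set of error patterns of the class `H` on the sample `w`, restricted to `R`. -/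
noncomputable def errorPatterns {X β : Type*} [Fintype β] (H : Set (Hypothesis X))
    (R : Set (Example X)) (w : β → Example X) : Finset (Finset β) :=
  Finset.univ.filter fun P => ∃ h ∈ H, errorPattern R w h = P

open Classical in
/-- The number of points of the sample `w` that lie in `R`. -/
noncomputable def hits {X β : Type*} [Fintype β] (R : Set (Example X)) (w : β → Example X) : ℕ :=
  (Finset.univ.filter fun b => w b ∈ R).card

theorem mem_errorPattern {X β : Type*} [Fintype β] {R : Set (Example X)} {w : β → Example X}
    {h : Hypothesis X} {b : β} : b ∈ errorPattern R w h ↔ w b ∈ R ∧ h (w b).1 ≠ (w b).2 := by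
  simp only [errorPattern, Finset.mem_filter, Finset.mem_univ, true_and]

theorem mem_errorPatterns {X β : Type*} [Fintype β] {H : Set (Hypothesis X)}
    {R : Set (Example X)} {w : β → Example X} {P : Finset β} :
    P ∈ errorPatterns H R w ↔ ∃ h ∈ H, errorPattern R w h = P := by
  simp only [errorPatterns, Finset.mem_filter, Finset.mem_univ, true_and]

theorem label_eq_of_ne_of_ne {a b c : Label} (h₁ : a ≠ c) (h₂ : b ≠ c) : a = b := by
  rcases Int.units_eq_one_or a with rfl | rfl <;> rcases Int.units_eq_one_or b with rfl | rfl <;>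
    rcases Int.units_eq_one_or c with rfl | rfl <;> simp_all

theorem card_le_of_shatters {X : Type*} {H : Set (Hypothesis X)} {d : ℕ}
    (hd : vcDim H ≤ (d : ℕ∞)) {s : Finset X} (hs : Shatters H s) : s.card ≤ d := by
  have : (s.card : ℕ∞) ≤ vcDim H := le_iSup₂_of_le (f := fun (s : Finset X) (_ : Shatters H s) =>
    (s.card : ℕ∞)) s hs le_rfl
  exact_mod_cast this.trans hd

/-- A set of indices shattered by the error patterns consists of hits of `R`, and has at most as
many elements as the VC dimension. -/
theorem errorPatterns_shatters {X β : Type*} [Fintype β] [DecidableEq β] {H : Set (Hypothesis X)}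
    {d : ℕ} (hd : vcDim H ≤ (d : ℕ∞)) {R : Set (Example X)} {w : β → Example X} {s : Finset β}
    (hs : (errorPatterns H R w).Shatters s) : (∀ b ∈ s, w b ∈ R) ∧ s.card ≤ d := by
  classical
  have key : ∀ t ⊆ s, ∃ h ∈ H, ∀ b ∈ s, (w b ∈ R ∧ h (w b).1 ≠ (w b).2) ↔ b ∈ t := by
    intro t ht
    obtain ⟨u, hu, hut⟩ := hs ht
    obtain ⟨h, hh, rfl⟩ := mem_errorPatterns.1 hu
    refine ⟨h, hh, fun b hb => ?_⟩
    rw [← hut, Finset.mem_inter]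
    simp [mem_errorPattern, hb]
  have hR : ∀ b ∈ s, w b ∈ R := by
    obtain ⟨h, -, hh⟩ := key s subset_rfl
    exact fun b hb => ((hh b hb).2 hb).1
  have hinj : Set.InjOn (fun b => (w b).1) s := by
    intro a ha b hb hab
    by_contra hne
    simp only at hab
    -- Two indices carrying the same point cannot both belong to a shattered set. With equal labels
    -- every `h` errs on both or on neither, so `{a}` is not cut out; with opposite labels no `h` is
    -- right on both, so `∅` is not.
    by_cases hy : (w a).2 = (w b).2
    · obtain ⟨h, -, hh⟩ := key {a} (by simpa using ha)
      have h1 := ((hh a ha).2 (by simp)).2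
      have h2 := (hh b hb).1 ⟨hR b hb, by rw [← hab, ← hy]; exact h1⟩
      exact hne (Finset.mem_singleton.1 h2).symm
    · obtain ⟨h, -, hh⟩ := key ∅ (by simp)
      have h1 : h (w a).1 = (w a).2 := by
        by_contra hc
        simpa using (hh a ha).1 ⟨hR a ha, hc⟩
      have h2 : h (w b).1 = (w b).2 := by
        by_contra hc
        simpa using (hh b hb).1 ⟨hR b hb, hc⟩
      exact hy (by rw [← h1, ← h2, hab])
  refine ⟨hR, ?_⟩
  rw [← Finset.card_image_of_injOn hinj]
  refine card_le_of_shatters hd fun f => ?_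
  -- To realize the labeling `f`, prescribe errors exactly where `f` disagrees with the observed
  -- label; with two labels this forces `h = f` on the points.
  obtain ⟨h, hH, hh⟩ := key (s.filter fun b => f (w b).1 ≠ (w b).2) (Finset.filter_subset _ _)
  refine ⟨h, hH, fun x hx => ?_⟩
  obtain ⟨b, hb, rfl⟩ := Finset.mem_image.1 hx
  have hb' := hh b hb
  simp only [Finset.mem_filter, hb, hR b hb, true_and] at hb'
  by_cases hf : f (w b).1 = (w b).2
  · rw [hf]
    by_contra hc
    exact hb'.1 hc hf
  · exact label_eq_of_ne_of_ne (hb'.2 hf) hf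

/-- An exponential form of the Sauer-Shelah bound. -/
theorem card_errorPatterns_le {X β : Type*} [Fintype β] {H : Set (Hypothesis X)}
    {d : ℕ} (hd : vcDim H ≤ (d : ℕ∞)) (R : Set (Example X)) (w : β → Example X)
    {x : ℝ} (hx0 : 0 < x) (hx1 : x ≤ 1) :
    ((errorPatterns H R w).card : ℝ) * x ^ d ≤ (1 + x) ^ hits R w := by
  classical
  set N := Finset.univ.filter fun b => w b ∈ R
  calc ((errorPatterns H R w).card : ℝ) * x ^ d
      ≤ ((errorPatterns H R w).shatterer.card : ℝ) * x ^ d := by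
        refine mul_le_mul_of_nonneg_right ?_ (by positivity)
        exact_mod_cast (errorPatterns H R w).card_le_card_shatterer
    _ = ∑ s ∈ (errorPatterns H R w).shatterer, x ^ d := by simp
    _ ≤ ∑ s ∈ (errorPatterns H R w).shatterer, x ^ s.card := by
        refine Finset.sum_le_sum fun s hs => ?_
        exact pow_le_pow_of_le_one hx0.le hx1
          (errorPatterns_shatters hd (Finset.mem_shatterer.1 hs)).2
    _ ≤ ∑ s ∈ N.powerset, x ^ s.card := by
        refine Finset.sum_le_sum_of_subset_of_nonneg (fun s hs => ?_) fun _ _ _ => by positivity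
        refine Finset.mem_powerset.2 fun b hb => ?_
        simpa [N] using (errorPatterns_shatters hd (Finset.mem_shatterer.1 hs)).1 b hb
    _ = (1 + x) ^ hits R w := by
        have := Finset.sum_pow_mul_eq_add_pow x 1 N
        simp only [one_pow, mul_one] at this
        rw [this, add_comm, hits]

/-! ### Exponential weights and symmetrization by swaps -/

open Classical in
/-- The factor that an example `z` contributes: `(1 + x)⁻¹` if `z ∈ R`, and an additional `r` if,
moreover, `h` errs on `z`. -/
noncomputable def weight {X : Type*} (r x : ℝ) (R : Set (Example X)) (h : Hypothesis X)
    (z : Example X) : ℝ :=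
  (if z ∈ R ∧ h z.1 ≠ z.2 then r else 1) * (if z ∈ R then (1 + x)⁻¹ else 1)

/-- Exchange the two components of `w a` for those `a` with `σ a`. -/
def swapPairs {Z κ : Type*} (σ : κ → Bool) (w : κ → Z × Z) : κ → Z × Z :=
  fun a => if σ a then (w a).swap else w a

/-- The two components of a sample of pairs, as one sample. -/
def unpair {Z κ : Type*} (w : κ → Z × Z) : κ × Bool → Z :=
  fun b => if b.2 then (w b.1).2 else (w b.1).1

/-- Swapping only permutes the double sample. Thus the normalization, which counts hits, is
unaffected, and `σ` enters only through which errors receive 1/2 and which 3/2. -/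
theorem prod_weight_swapPairs {X κ : Type*} [Fintype κ] [DecidableEq κ] {x : ℝ}
    (R : Set (Example X)) (h : Hypothesis X) (w : κ → Example X × Example X) (σ : κ → Bool) :
    ∏ a, (weight (1 / 2) x R h (swapPairs σ w a).1 * weight (3 / 2) x R h (swapPairs σ w a).2) =
      (∏ a, ((if (a, σ a) ∈ errorPattern R (unpair w) h then (1 / 2 : ℝ) else 1) *
        (if (a, !σ a) ∈ errorPattern R (unpair w) h then (3 / 2 : ℝ) else 1))) *
      ((1 + x) ^ hits R (unpair w))⁻¹ := by
  classical
  have h1 : ((1 + x) ^ hits R (unpair w))⁻¹ =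
      ∏ b : κ × Bool, (if unpair w b ∈ R then (1 + x)⁻¹ else 1) := by
    rw [Finset.prod_ite]
    simp [hits]
  rw [h1, Fintype.prod_prod_type, ← Finset.prod_mul_distrib]
  refine Finset.prod_congr rfl fun a _ => ?_
  cases hσ : σ a <;> simp only [weight, swapPairs, unpair, mem_errorPattern, hσ, Fintype.univ_bool,
    Finset.prod_insert, Finset.prod_singleton, Finset.mem_singleton, Bool.not_true, Bool.not_false,
    Prod.fst_swap, Prod.snd_swap, Bool.false_eq_true, if_true, if_false, reduceCtorEq,
    not_false_eq_true] <;> ring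

/-- The sum over `σ` factors over the pairs. A pair contributes 1/2 + 3/2 = 2 if it contains one
error, 2 · 3/4 if it contains two, and 2 if it contains none. -/
theorem sum_bool_pattern_le {κ : Type*} [Fintype κ] [DecidableEq κ] (P : Finset (κ × Bool)) :
    ∑ σ : κ → Bool, ∏ a, ((if (a, σ a) ∈ P then (1 / 2 : ℝ) else 1) *
      (if (a, !σ a) ∈ P then (3 / 2 : ℝ) else 1)) ≤ 2 ^ Fintype.card κ := by
  have := Finset.prod_univ_sum (fun _ : κ => (Finset.univ : Finset Bool))
    (fun a s => ((if (a, s) ∈ P then (1 / 2 : ℝ) else 1) * (if (a, !s) ∈ P then (3 / 2 : ℝ) else 1)))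
  rw [Fintype.piFinset_univ] at this
  rw [← this, ← Finset.card_univ, ← Finset.prod_const]
  refine Finset.prod_le_prod (fun a _ => Finset.sum_nonneg fun s _ => ?_) fun a _ => ?_
  · split_ifs <;> norm_num
  · rw [Fintype.sum_bool]
    simp only [Bool.not_true, Bool.not_false]
    split_ifs <;> norm_num

/-- The average over a nonempty finite family. -/
noncomputable def avg {ι : Type*} [Fintype ι] (f : ι → ℝ) : ℝ :=
  (Fintype.card ι : ℝ)⁻¹ * ∑ i, f i

theorem avg_le {ι : Type*} [Fintype ι] [Nonempty ι] {f : ι → ℝ} {c : ℝ} (h : ∀ i, f i ≤ c) :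
    avg f ≤ c := by
  have h0 : (0 : ℝ) < Fintype.card ι := by exact_mod_cast Fintype.card_pos
  have h1 : ∑ i, f i ≤ Fintype.card ι * c := by
    simpa using Finset.sum_le_sum fun i (_ : i ∈ Finset.univ) => h i
  rw [avg, inv_mul_le_iff₀ h0]
  exact h1

/-- The hypotheses depend on `σ` through the sample, but their error patterns belong to a set of
patterns of the double sample that does not. Summing over this whole set removes the dependence, and
the factor `(1 + x)⁻¹` per hit cancels the growth allowed by Sauer-Shelah. -/
theorem sum_swapPairs_le {X κ ι : Type*} [Fintype κ] [DecidableEq κ] [Fintype ι] [Nonempty ι]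
    {H : Set (Hypothesis X)} {d : ℕ} (hd : vcDim H ≤ (d : ℕ∞)) (R : Set (Example X))
    (h : ι → (κ → Example X) → Hypothesis X) (hH : ∀ i S, h i S ∈ H)
    {x : ℝ} (hx0 : 0 < x) (hx1 : x ≤ 1) (w : κ → Example X × Example X) :
    ∑ σ : κ → Bool, avg (fun i => ∏ a,
      (weight (1 / 2) x R (h i fun a => (swapPairs σ w a).1) (swapPairs σ w a).1 *
        weight (3 / 2) x R (h i fun a => (swapPairs σ w a).1) (swapPairs σ w a).2)) ≤
      2 ^ Fintype.card κ * (x ^ d)⁻¹ := by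
  set g : Finset (κ × Bool) → (κ → Bool) → ℝ := fun P σ =>
    ∏ a, ((if (a, σ a) ∈ P then (1 / 2 : ℝ) else 1) * (if (a, !σ a) ∈ P then (3 / 2 : ℝ) else 1))
  have hg : ∀ P σ, 0 ≤ g P σ := fun P σ => Finset.prod_nonneg fun a _ => by
    split_ifs <;> norm_num
  set q := ((1 + x) ^ hits R (unpair w))⁻¹
  have hq : 0 < q := by positivity
  calc _ ≤ ∑ σ : κ → Bool, (∑ P ∈ errorPatterns H R (unpair w), g P σ) * q := by
        refine Finset.sum_le_sum fun σ _ => avg_le fun i => ?_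
        rw [prod_weight_swapPairs]
        refine mul_le_mul_of_nonneg_right ?_ hq.le
        refine Finset.single_le_sum (f := fun P => g P σ) (fun P _ => hg P σ) ?_
        exact mem_errorPatterns.2 ⟨_, hH _ _, rfl⟩
    _ = (∑ P ∈ errorPatterns H R (unpair w), ∑ σ : κ → Bool, g P σ) * q := by
        rw [← Finset.sum_mul, Finset.sum_comm]
    _ ≤ (∑ P ∈ errorPatterns H R (unpair w), 2 ^ Fintype.card κ) * q := by
        gcongr with P
        exact sum_bool_pattern_le P
    _ ≤ _ := by
        have := card_errorPatterns_le hd R (unpair w) hx0 hx1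
        rw [Finset.sum_const, nsmul_eq_mul, mul_comm _ ((2 : ℝ) ^ _), mul_assoc]
        gcongr
        rw [← div_eq_mul_inv, div_le_iff₀ (by positivity), ← div_eq_inv_mul, le_div_iff₀ (by positivity)]
        exact this

/-! ### Mean weights, and a Chernoff bound for hits -/

section

theorem measurableSet_ne_label {α : Type*} [MeasurableSpace α] {f g : α → Label}
    (hf : Measurable f) (hg : Measurable g) : MeasurableSet {a | f a ≠ g a} :=
  (hf.prodMk hg) (MeasurableSet.of_discrete (s := {p : Label × Label | p.1 ≠ p.2}))

/-- A bounded measurable real function is integrable with respect to a finite measure. -/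
theorem integrable_of_measurable_of_bound {α : Type*} [MeasurableSpace α] {μ : Measure α}
    [IsFiniteMeasure μ] {f : α → ℝ} (hf : Measurable f) (C : ℝ) (h0 : ∀ a, 0 ≤ f a)
    (hC : ∀ a, f a ≤ C) : Integrable f μ :=
  Integrable.of_bound hf.aestronglyMeasurable C
    (Filter.Eventually.of_forall fun a => by rw [Real.norm_of_nonneg (h0 a)]; exact hC a)

/-- Markov's inequality in the form in which exponential moments are used. -/
theorem measureReal_ge_le_of_integral_le {α : Type*} [MeasurableSpace α] {μ : Measure α}
    [IsFiniteMeasure μ] {f : α → ℝ} (hf : Integrable f μ) (h0 : ∀ a, 0 ≤ f a) {M δ : ℝ}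
    (hM : 0 < M) (hδ : 0 < δ) (h : ∫ a, f a ∂μ ≤ M) : μ.real {a | M / δ ≤ f a} ≤ δ := by
  have := mul_meas_ge_le_integral_of_nonneg (Filter.Eventually.of_forall h0) hf (M / δ)
  have h2 : M / δ * μ.real {a | M / δ ≤ f a} ≤ M / δ * δ := by
    rw [div_mul_cancel₀ _ hδ.ne']; exact this.trans h
  exact le_of_mul_le_mul_left h2 (by positivity)

theorem weight_nonneg {X : Type*} {r x : ℝ} (hr : 0 ≤ r) (hx : 0 ≤ x) (R : Set (Example X))
    (h : Hypothesis X) (z : Example X) : 0 ≤ weight r x R h z := by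
  unfold weight
  split_ifs <;> positivity

theorem weight_le {X : Type*} {r x : ℝ} (hr : 0 ≤ r) (hr2 : r ≤ 2) (hx : 0 ≤ x)
    (R : Set (Example X)) (h : Hypothesis X) (z : Example X) : weight r x R h z ≤ 2 := by
  have h1 : (1 + x)⁻¹ ≤ 1 := inv_le_one_of_one_le₀ (by linarith)
  have h2 : 0 ≤ (1 + x)⁻¹ := by positivity
  unfold weight
  split_ifs <;> nlinarith

theorem measurable_weight {X α : Type*} [MeasurableSpace X] [MeasurableSpace α] {r x : ℝ}
    {R : Set (Example X)} (hR : MeasurableSet R) {h : α → Hypothesis X}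
    (hh : Measurable fun p : α × X => h p.1 p.2) {u : α → Example X} (hu : Measurable u) :
    Measurable fun a => weight r x R (h a) (u a) := by
  have h1 : MeasurableSet {a | u a ∈ R} := hu hR
  have h2 : MeasurableSet {a | h a (u a).1 ≠ (u a).2} :=
    measurableSet_ne_label (hh.comp (measurable_id.prodMk hu.fst)) hu.snd
  exact (Measurable.ite (h1.inter h2) measurable_const measurable_const).mul
    (Measurable.ite h1 measurable_const measurable_const)

/-- The weight loses `x / (1 + x) ≤ x` on `R` and gains `1 / (2 * (1 + x)) ≥ 1 / 4` on the errors in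
`R`. -/
theorem le_integral_weight {X : Type*} [MeasurableSpace X] (D : Measure (Example X))
    [IsProbabilityMeasure D] {x : ℝ} (hx0 : 0 < x) (hx1 : x ≤ 1) {R : Set (Example X)}
    (hR : MeasurableSet R) {h : Hypothesis X} (hh : Measurable h) :
    1 + D.real (R ∩ {z | h z.1 ≠ z.2}) / 4 - D.real R * x ≤
      ∫ z, weight (3 / 2) x R h z ∂D := by
  have hP : MeasurableSet (R ∩ {z : Example X | h z.1 ≠ z.2}) :=
    hR.inter (measurableSet_ne_label (hh.comp measurable_fst) measurable_snd)
  set P := R ∩ {z : Example X | h z.1 ≠ z.2}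
  have hw : ∀ z, weight (3 / 2) x R h z = 1 - R.indicator (fun _ => x / (1 + x)) z +
      P.indicator (fun _ => 1 / (2 * (1 + x))) z := by
    intro z
    have : (1 + x) ≠ 0 := by positivity
    by_cases h1 : z ∈ R
    · by_cases h2 : h z.1 = z.2
      · simp [weight, P, h1, h2]
        field_simp
        ring
      · simp [weight, P, h1, h2]
        field_simp
        ring
    · simp [weight, P, h1]
  simp_rw [hw]
  rw [integral_add, integral_sub, integral_indicator_const _ hR, integral_indicator_const _ hP]
  · have hp : 0 ≤ D.real P := measureReal_nonneg
    have hq : 0 ≤ D.real R := measureReal_nonneg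
    have e1 : x / (1 + x) ≤ x := div_le_self hx0.le (by linarith)
    have e2 : 1 / 4 ≤ 1 / (2 * (1 + x)) := by
      apply one_div_le_one_div_of_le <;> linarith
    simp only [integral_const, probReal_univ, smul_eq_mul]
    nlinarith
  · exact integrable_const _
  · exact (integrable_const _).indicator hR
  · exact (integrable_const _).sub ((integrable_const _).indicator hR)
  · exact (integrable_const _).indicator hP

variable {X κ ι : Type*} [Fintype κ] [Fintype ι]

/-- The average over the family `h` of the weights of a sample `S`, on which the family depends,
and of a ghost sample `G`. -/
noncomputable def ghostWeight (x : ℝ) (R : Set (Example X))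
    (h : ι → (κ → Example X) → Hypothesis X) (S G : κ → Example X) : ℝ :=
  avg fun i => ∏ a, (weight (1 / 2) x R (h i S) (S a) * weight (3 / 2) x R (h i S) (G a))

theorem avg_nonneg {f : ι → ℝ} (h : ∀ i, 0 ≤ f i) : 0 ≤ avg f :=
  mul_nonneg (by positivity) (Finset.sum_nonneg fun i _ => h i)

theorem avg_mono {f g : ι → ℝ} (h : ∀ i, f i ≤ g i) : avg f ≤ avg g :=
  mul_le_mul_of_nonneg_left (Finset.sum_le_sum fun i _ => h i) (by positivity)

theorem ghostWeight_nonneg {x : ℝ} (hx : 0 ≤ x) (R : Set (Example X))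
    (h : ι → (κ → Example X) → Hypothesis X) (S G : κ → Example X) :
    0 ≤ ghostWeight x R h S G :=
  avg_nonneg fun _ => Finset.prod_nonneg fun _ _ =>
    mul_nonneg (weight_nonneg (by norm_num) hx _ _ _) (weight_nonneg (by norm_num) hx _ _ _)

theorem ghostWeight_le [Nonempty ι] {x : ℝ} (hx : 0 ≤ x) (R : Set (Example X))
    (h : ι → (κ → Example X) → Hypothesis X) (S G : κ → Example X) :
    ghostWeight x R h S G ≤ 4 ^ Fintype.card κ := by
  refine avg_le fun i => ?_
  rw [← Finset.card_univ, ← Finset.prod_const]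
  refine Finset.prod_le_prod (fun a _ => mul_nonneg (weight_nonneg (by norm_num) hx _ _ _)
    (weight_nonneg (by norm_num) hx _ _ _)) fun a _ => ?_
  have h1 := weight_le (r := 1 / 2) (by norm_num) (by norm_num) hx R (h i S) (S a)
  have h2 := weight_le (r := 3 / 2) (by norm_num) (by norm_num) hx R (h i S) (G a)
  have h3 := weight_nonneg (r := 3 / 2) (by norm_num) hx R (h i S) (G a)
  nlinarith

variable [MeasurableSpace X]

theorem measurable_ghostWeight {x : ℝ} {R : Set (Example X)} (hR : MeasurableSet R)
    {h : ι → (κ → Example X) → Hypothesis X}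
    (hh : ∀ i, Measurable fun p : (κ → Example X) × X => h i p.1 p.2) :
    Measurable fun p : (κ → Example X) × (κ → Example X) => ghostWeight x R h p.1 p.2 := by
  unfold ghostWeight avg
  refine (Finset.measurable_sum _ fun i _ => Finset.measurable_prod _ fun a _ => ?_).const_mul _
  have h1 : Measurable fun q : ((κ → Example X) × (κ → Example X)) × X => h i q.1.1 q.2 :=
    (hh i).comp (measurable_fst.fst.prodMk measurable_snd)
  exact (measurable_weight hR h1 (by fun_prop)).mul (measurable_weight hR h1 (by fun_prop))

theorem measurePreserving_swapPairs {Z : Type*} [MeasurableSpace Z] (D : Measure Z)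
    [IsProbabilityMeasure D] (σ : κ → Bool) :
    MeasurePreserving (swapPairs σ) (Measure.pi fun _ : κ => D.prod D)
      (Measure.pi fun _ : κ => D.prod D) := by
  refine measurePreserving_pi (fun _ : κ => D.prod D) (fun _ => D.prod D)
    (f := fun a z => if σ a then z.swap else z) fun a => ?_
  cases σ a
  · simp only [Bool.false_eq_true, if_false]
    exact MeasurePreserving.id _
  · simpa using Measure.measurePreserving_swap

/-- Every swap preserves the law of the i.i.d. pairs, so the mean equals its average over all swaps,
which is bounded pointwise. -/
theorem integral_ghostWeight_le [Nonempty ι] (D : Measure (Example X)) [IsProbabilityMeasure D]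
    {H : Set (Hypothesis X)} {d : ℕ} (hd : vcDim H ≤ (d : ℕ∞)) {R : Set (Example X)}
    (hR : MeasurableSet R) {h : ι → (κ → Example X) → Hypothesis X} (hH : ∀ i S, h i S ∈ H)
    (hh : ∀ i, Measurable fun p : (κ → Example X) × X => h i p.1 p.2)
    {x : ℝ} (hx0 : 0 < x) (hx1 : x ≤ 1) :
    ∫ p, ghostWeight x R h p.1 p.2
      ∂((Measure.pi fun _ : κ => D).prod (Measure.pi fun _ : κ => D)) ≤ (x ^ d)⁻¹ := by
  classical
  set μ := Measure.pi fun _ : κ => D.prod D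
  set f : (κ → Example X × Example X) → ℝ :=
    fun w => ghostWeight x R h (fun a => (w a).1) (fun a => (w a).2)
  have hw : Measurable fun w : κ → Example X × Example X =>
      ((fun a => (w a).1), (fun a => (w a).2)) := by fun_prop
  have hf : Measurable f := by
    have := (measurable_ghostWeight (x := x) hR hh).comp hw
    exact this
  have e1 : ∫ p, ghostWeight x R h p.1 p.2
      ∂((Measure.pi fun _ : κ => D).prod (Measure.pi fun _ : κ => D)) = ∫ w, f w ∂μ :=
    ((measurePreserving_arrowProdEquivProdArrow (Example X) (Example X) κ (fun _ => D)
      (fun _ => D)).integral_comp' (fun p => ghostWeight x R h p.1 p.2)).symm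
  have e2 : ∀ σ : κ → Bool, ∫ w, f (swapPairs σ w) ∂μ = ∫ w, f w ∂μ := by
    intro σ
    have hσ := measurePreserving_swapPairs D σ
    conv_rhs => rw [show μ = Measure.map (swapPairs σ) μ from hσ.map_eq.symm]
    exact (integral_map hσ.measurable.aemeasurable hf.aestronglyMeasurable).symm
  have hint : ∀ σ : κ → Bool, Integrable (fun w => f (swapPairs σ w)) μ := fun σ =>
    integrable_of_measurable_of_bound (hf.comp (measurePreserving_swapPairs D σ).measurable)
      (4 ^ Fintype.card κ) (fun w => ghostWeight_nonneg hx0.le _ _ _ _)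
      (fun w => ghostWeight_le hx0.le _ _ _ _)
  have e3 : (2 : ℝ) ^ Fintype.card κ * ∫ w, f w ∂μ ≤ 2 ^ Fintype.card κ * (x ^ d)⁻¹ := by
    calc (2 : ℝ) ^ Fintype.card κ * ∫ w, f w ∂μ = ∑ σ : κ → Bool, ∫ w, f (swapPairs σ w) ∂μ := by
          simp_rw [e2]
          simp
      _ = ∫ w, ∑ σ : κ → Bool, f (swapPairs σ w) ∂μ :=
          (integral_finsetSum _ fun σ _ => hint σ).symm
      _ ≤ ∫ _, 2 ^ Fintype.card κ * (x ^ d)⁻¹ ∂μ :=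
          integral_mono (integrable_finsetSum _ fun σ _ => hint σ) (integrable_const _)
            fun w => sum_swapPairs_le hd R h hH hx0 hx1 w
      _ = _ := by simp
  rw [e1]
  exact le_of_mul_le_mul_left e3 (by positivity)

theorem measurable_hits {R : Set (Example X)} (hR : MeasurableSet R) :
    Measurable fun S : κ → Example X => (hits R S : ℝ) := by
  classical
  have : (fun S : κ → Example X => (hits R S : ℝ)) =
      fun S => ∑ a, if S a ∈ R then (1 : ℝ) else 0 := by
    funext S
    simp [hits]
  rw [this]
  exact Finset.measurable_sum _ fun a _ =>
    Measurable.ite (measurable_pi_apply a hR) measurable_const measurable_const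

/-- A Chernoff bound for the number of hits. -/
theorem measureReal_hits_gt_le (D : Measure (Example X)) [IsProbabilityMeasure D]
    {R : Set (Example X)} (hR : MeasurableSet R) {δ : ℝ} (hδ : 0 < δ) :
    (Measure.pi fun _ : κ => D).real
      {S | 2 * D.real R * Fintype.card κ + Real.log (1 / δ) < hits R S} ≤ δ := by
  classical
  set n := Fintype.card κ
  have h1 : ∀ S : κ → Example X, Real.exp (hits R S) =
      ∏ a, (if S a ∈ R then Real.exp 1 else 1) := by
    intro S
    rw [Finset.prod_ite]
    simp [hits, ← Real.exp_nat_mul]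
  -- The factor 2 absorbs `e - 1`: the integral is `1 + (e - 1) * q ≤ exp (2 * q)`, with `q` the
  -- mass of `R`.
  have h2 : ∫ z, (if z ∈ R then Real.exp 1 else 1) ∂D ≤ Real.exp (2 * D.real R) := by
    have : ∀ z, (if z ∈ R then Real.exp 1 else 1) =
        1 + R.indicator (fun _ => Real.exp 1 - 1) z := by
      intro z
      by_cases hz : z ∈ R <;> simp [hz]
    simp_rw [this]
    rw [integral_add (integrable_const _) ((integrable_const _).indicator hR),
      integral_indicator_const _ hR]
    have h3 := Real.exp_one_lt_d9
    have h4 := Real.add_one_le_exp (2 * D.real R)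
    have h5 : 0 ≤ D.real R := measureReal_nonneg
    simp only [integral_const, probReal_univ, smul_eq_mul]
    nlinarith
  have h3 : ∫ S : κ → Example X, Real.exp (hits R S) ∂(Measure.pi fun _ : κ => D) ≤
      Real.exp (2 * D.real R * n) := by
    simp_rw [h1]
    rw [integral_fintype_prod_eq_pow (𝕜 := ℝ) (fun z => if z ∈ R then Real.exp 1 else 1),
      mul_comm _ (n : ℝ), Real.exp_nat_mul]
    refine pow_le_pow_left₀ (integral_nonneg fun z => ?_) h2 _
    dsimp only
    split_ifs <;> positivity
  have h4 : Integrable (fun S : κ → Example X => Real.exp (hits R S)) (Measure.pi fun _ : κ => D) :=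
    integrable_of_measurable_of_bound (measurable_hits hR).exp (Real.exp n)
      (fun S => by positivity) fun S => Real.exp_le_exp.2 (by
        have : hits R S ≤ n := Finset.card_filter_le _ _
        exact_mod_cast this)
  refine le_trans (measureReal_mono fun S hS => ?_) (measureReal_ge_le_of_integral_le h4
    (fun S => by positivity) (Real.exp_pos _) hδ h3)
  have hS' : 2 * D.real R * n + Real.log (1 / δ) < hits R S := hS
  have := Real.exp_le_exp.2 hS'.le
  rwa [Real.exp_add, Real.exp_log (by positivity), mul_one_div] at this

end

/-! ### The localized relative deviation bound -/

section

/-- Jensen's inequality for powers; it turns a bound on each member's mean weight into one in terms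
of the family's average error. -/
theorem avg_pow_le {ι : Type*} [Fintype ι] [Nonempty ι] {f : ι → ℝ} (hf : ∀ i, 0 ≤ f i) (n : ℕ) :
    avg f ^ n ≤ avg fun i => f i ^ n := by
  have h0 : (Fintype.card ι : ℝ) ≠ 0 := by exact_mod_cast Fintype.card_ne_zero
  have := Real.pow_arith_mean_le_arith_mean_pow Finset.univ (fun _ : ι => (Fintype.card ι : ℝ)⁻¹) f
    (fun _ _ => by positivity) (by simp [h0]) (fun i _ => hf i) n
  simpa only [avg, ← Finset.mul_sum] using this

theorem avg_affine {ι : Type*} [Fintype ι] [Nonempty ι] (f : ι → ℝ) (a b c : ℝ) :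
    (avg fun i => a + f i / b - c) = a + avg f / b - c := by
  have h0 : (Fintype.card ι : ℝ) ≠ 0 := by exact_mod_cast Fintype.card_ne_zero
  simp only [avg, Finset.sum_sub_distrib, Finset.sum_add_distrib, Finset.sum_const,
    Finset.card_univ, nsmul_eq_mul, ← Finset.sum_div]
  field_simp

theorem avg_const_mul {ι : Type*} [Fintype ι] (f : ι → ℝ) (c : ℝ) :
    (avg fun i => c * f i) = c * avg f := by
  simp only [avg, ← Finset.mul_sum]
  ring

theorem exp_half_le_one_add {u : ℝ} (h0 : 0 ≤ u) (h1 : u ≤ 1) : Real.exp (u / 2) ≤ 1 + u := by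
  have h2 := Real.add_one_le_exp (-(u / 2))
  rw [Real.exp_neg] at h2
  have h3 := Real.exp_pos (u / 2)
  have h4 : (-(u / 2) + 1) * Real.exp (u / 2) ≤ 1 := by
    calc _ ≤ (Real.exp (u / 2))⁻¹ * Real.exp (u / 2) := by gcongr
      _ = 1 := inv_mul_cancel₀ h3.ne'
  nlinarith

theorem exp_le_prod_weight {X κ : Type*} [Fintype κ] {x : ℝ} (hx : 0 ≤ x) (R : Set (Example X))
    (h : Hypothesis X) (S : κ → Example X) {b : ℝ} (hb : (errorPattern R S h).card ≤ b) :
    Real.exp (-b - x * hits R S) ≤ ∏ a, weight (1 / 2) x R h (S a) := by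
  classical
  have e : ∏ a, weight (1 / 2) x R h (S a) =
      (1 / 2) ^ (errorPattern R S h).card * (1 + x)⁻¹ ^ hits R S := by
    simp only [weight, Finset.prod_mul_distrib, Finset.prod_ite, errorPattern, hits,
      Finset.prod_const, one_pow, mul_one]
  have h1 : Real.exp (-1) ≤ 1 / 2 := by
    rw [Real.exp_neg, ← one_div]
    have := Real.exp_one_gt_d9
    exact one_div_le_one_div_of_le (by norm_num) (by linarith)
  have h2 : Real.exp (-x) ≤ (1 + x)⁻¹ := by
    rw [Real.exp_neg]
    have := Real.add_one_le_exp x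
    exact inv_anti₀ (by positivity) (by linarith)
  calc Real.exp (-b - x * hits R S)
      ≤ Real.exp (((errorPattern R S h).card : ℝ) * (-1) + hits R S * (-x)) :=
        Real.exp_le_exp.2 (by linarith)
    _ = Real.exp (-1) ^ (errorPattern R S h).card * Real.exp (-x) ^ hits R S := by
        rw [Real.exp_add, Real.exp_nat_mul, Real.exp_nat_mul]
    _ ≤ _ := by
        rw [e]
        gcongr

variable {X κ ι : Type*} [MeasurableSpace X] [Fintype κ] [Fintype ι] [Nonempty ι]

theorem integrable_ghostWeight (μ : Measure ((κ → Example X) × (κ → Example X)))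
    [IsFiniteMeasure μ] {x : ℝ} (hx : 0 ≤ x) {R : Set (Example X)} (hR : MeasurableSet R)
    {h : ι → (κ → Example X) → Hypothesis X}
    (hh : ∀ i, Measurable fun p : (κ → Example X) × X => h i p.1 p.2) :
    Integrable (fun p : (κ → Example X) × (κ → Example X) => ghostWeight x R h p.1 p.2) μ :=
  integrable_of_measurable_of_bound (measurable_ghostWeight hR hh) (4 ^ Fintype.card κ)
    (fun _ => ghostWeight_nonneg hx _ _ _ _) (fun _ => ghostWeight_le hx _ _ _ _)

/-- For fixed `S` the ghost examples are independent, so each ghost product integrates to a power of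
a one-point mean. The sample factor is bounded below uniformly in `i`, after which convexity moves
the average inside the power. -/
theorem le_integral_ghostWeight (D : Measure (Example X)) [IsProbabilityMeasure D]
    {R : Set (Example X)} (hR : MeasurableSet R) {h : ι → (κ → Example X) → Hypothesis X}
    (hh : ∀ i, Measurable fun p : (κ → Example X) × X => h i p.1 p.2)
    {x : ℝ} (hx0 : 0 < x) (hx1 : x ≤ 1) (S : κ → Example X) {b : ℝ}
    (hb : ∀ i, (errorPattern R S (h i S)).card ≤ b) :
    Real.exp (-b - x * hits R S) *
      (1 + (avg fun i => D.real (R ∩ {z | h i S z.1 ≠ z.2})) / 4 - D.real R * x) ^ Fintype.card κ ≤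
      ∫ G, ghostWeight x R h S G ∂(Measure.pi fun _ : κ => D) := by
  have hS : ∀ i, Measurable (h i S) := fun i => (hh i).comp measurable_prodMk_left
  have e : ∫ G, ghostWeight x R h S G ∂(Measure.pi fun _ : κ => D) =
      avg fun i => (∏ a, weight (1 / 2) x R (h i S) (S a)) *
        (∫ z, weight (3 / 2) x R (h i S) z ∂D) ^ Fintype.card κ := by
    simp only [ghostWeight, avg, Finset.prod_mul_distrib]
    rw [integral_const_mul, integral_finsetSum]
    · congr 1
      refine Finset.sum_congr rfl fun i _ => ?_
      rw [integral_const_mul]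
      congr 1
      exact integral_fintype_prod_eq_pow (𝕜 := ℝ) (fun z => weight (3 / 2) x R (h i S) z)
    · intro i _
      refine Integrable.const_mul (integrable_of_measurable_of_bound
        (Finset.measurable_prod _ fun a _ => ?_) (2 ^ Fintype.card κ) (fun G => ?_) fun G => ?_) _
      · exact measurable_weight hR (h := fun _ => h i S) ((hS i).comp measurable_snd)
          (measurable_pi_apply a)
      · exact Finset.prod_nonneg fun a _ => weight_nonneg (by norm_num) hx0.le _ _ _
      · rw [← Finset.card_univ, ← Finset.prod_const]
        exact Finset.prod_le_prod (fun a _ => weight_nonneg (by norm_num) hx0.le _ _ _)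
          fun a _ => weight_le (by norm_num) (by norm_num) hx0.le _ _ _
  have hq : D.real R * x ≤ 1 := mul_le_one₀ measureReal_le_one hx0.le hx1
  have hnn : ∀ i, 0 ≤ 1 + D.real (R ∩ {z | h i S z.1 ≠ z.2}) / 4 - D.real R * x := fun i => by
    have : 0 ≤ D.real (R ∩ {z | h i S z.1 ≠ z.2}) := measureReal_nonneg
    linarith
  rw [e, ← avg_affine]
  refine (mul_le_mul_of_nonneg_left (avg_pow_le hnn _) (Real.exp_nonneg _)).trans ?_
  rw [← avg_const_mul]
  refine avg_mono fun i => ?_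
  refine mul_le_mul (exp_le_prod_weight hx0.le _ _ _ (hb i))
    (pow_le_pow_left₀ (hnn i) (le_integral_weight D hx0 hx1 hR (hS i)) _)
    (pow_nonneg (hnn i) _)
    (Finset.prod_nonneg fun a _ => weight_nonneg (by norm_num) hx0.le _ _ _)

/-- A relative deviation bound, localized to the set `R`, for finitely many sample-dependent
hypotheses from a class of VC dimension at most `d`. -/
theorem measureReal_relative_deviation_le [Nonempty κ] (D : Measure (Example X))
    [IsProbabilityMeasure D] {H : Set (Hypothesis X)} {d : ℕ} (hd : vcDim H ≤ (d : ℕ∞))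
    {R : Set (Example X)} (hR : MeasurableSet R) {h : ι → (κ → Example X) → Hypothesis X}
    (hH : ∀ i S, h i S ∈ H)
    (hh : ∀ i, Measurable fun p : (κ → Example X) × X => h i p.1 p.2)
    {x : ℝ} (hx0 : 0 < x) (hx1 : x ≤ 1) {δ : ℝ} (hδ0 : 0 < δ) (hδ1 : δ ≤ 1)
    {b : (κ → Example X) → ℝ} (hb : ∀ S i, (errorPattern R S (h i S)).card ≤ b S) :
    (Measure.pi fun _ : κ => D).real
      {S | 20 * D.real R * x +
        8 / Fintype.card κ * (b S + d * Real.log (1 / x) + 2 * Real.log (1 / δ)) <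
        avg fun i => D.real (R ∩ {z | h i S z.1 ≠ z.2})} ≤ 2 * δ := by
  set n := Fintype.card κ
  have hn : (0 : ℝ) < n := by exact_mod_cast Fintype.card_pos
  set ψ : (κ → Example X) → ℝ := fun S => ∫ G, ghostWeight x R h S G ∂(Measure.pi fun _ : κ => D)
  have hψ0 : ∀ S, 0 ≤ ψ S := fun S => integral_nonneg fun G => ghostWeight_nonneg hx0.le _ _ _ _
  have hint := integrable_ghostWeight
    ((Measure.pi fun _ : κ => D).prod (Measure.pi fun _ : κ => D)) hx0.le hR hh
  have hψ : Integrable ψ (Measure.pi fun _ : κ => D) := hint.integral_prod_left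
  have hψi : ∫ S, ψ S ∂(Measure.pi fun _ : κ => D) ≤ (x ^ d)⁻¹ := by
    have := integral_ghostWeight_le D hd hR hH hh hx0 hx1
    rwa [integral_prod _ hint] at this
  have h1 := measureReal_ge_le_of_integral_le hψ hψ0 (by positivity) hδ0 hψi
  have h2 := measureReal_hits_gt_le (κ := κ) D hR hδ0
  rw [two_mul δ]
  -- One `δ` pays for Markov's inequality applied to the mean ghost weight, the other for the bound
  -- on the hits.
  refine le_trans ?_ ((measureReal_union_le _ _).trans (add_le_add h1 h2))
  refine measureReal_mono fun S hS => ?_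
  by_cases hN : 2 * D.real R * n + Real.log (1 / δ) < hits R S
  · exact Or.inr hN
  left
  push Not at hN
  have hS' : 20 * D.real R * x + 8 / n * (b S + d * Real.log (1 / x) + 2 * Real.log (1 / δ)) <
        avg fun i => D.real (R ∩ {z | h i S z.1 ≠ z.2}) := hS
  refine le_trans ?_ (le_integral_ghostWeight D hR hh hx0 hx1 S (hb S))
  set p := avg fun i => D.real (R ∩ {z | h i S z.1 ≠ z.2})
  have hp1 : p ≤ 1 := avg_le fun i => measureReal_le_one
  have hq0 : 0 ≤ D.real R := measureReal_nonneg
  set q := D.real R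
  have hb0 : 0 ≤ b S := le_trans (Nat.cast_nonneg _) (hb S (Classical.arbitrary ι))
  have hlx : 0 ≤ Real.log (1 / x) := Real.log_nonneg (by rw [le_div_iff₀ hx0]; linarith)
  have hlδ : 0 ≤ Real.log (1 / δ) := Real.log_nonneg (by rw [le_div_iff₀ hδ0]; linarith)
  set B := b S + d * Real.log (1 / x) + 2 * Real.log (1 / δ) with hB
  have hB0 : 0 ≤ B := by positivity
  have hqx : 0 ≤ q * x := by positivity
  have hnB : 0 ≤ 8 / n * B := by positivity
  have hu0 : 0 ≤ p / 4 - q * x := by nlinarith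
  have hu1 : p / 4 - q * x ≤ 1 := by linarith
  have hnp : n * (20 * q * x) + 8 * B ≤ n * p := by
    have := mul_le_mul_of_nonneg_left hS'.le hn.le
    rw [mul_add, ← mul_assoc (n : ℝ) (8 / n), mul_div_cancel₀ _ hn.ne'] at this
    exact this
  have hxN : x * hits R S ≤ 2 * (n * (q * x)) + Real.log (1 / δ) := by
    nlinarith [mul_le_mul_of_nonneg_left hN hx0.le]
  -- With `x * hits ≤ 2 * n * q * x + log (1 / δ)`, the exponent comparison needs `n * p / 8 ≥ B +
  -- (5 / 2) * n * q * x`. This is the origin of the constants 8 and 20.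
  calc (x ^ d)⁻¹ / δ = Real.exp (d * Real.log (1 / x) + Real.log (1 / δ)) := by
        rw [Real.exp_add, Real.exp_nat_mul, Real.exp_log (by positivity),
          Real.exp_log (by positivity), one_div, inv_pow, one_div, div_eq_mul_inv]
    _ ≤ Real.exp ((-b S - x * hits R S) + n * ((p / 4 - q * x) / 2)) :=
        Real.exp_le_exp.2 (by nlinarith)
    _ = Real.exp (-b S - x * hits R S) * Real.exp ((p / 4 - q * x) / 2) ^ n := by
        rw [Real.exp_add, Real.exp_nat_mul]
    _ ≤ _ := by
        gcongr
        rw [add_sub_assoc]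
        exact exp_half_le_one_add hu0 hu1

end

/-! ### Combinatorics of the splitting algorithm -/

section

theorem splits_add_six {Z : Type*} (k : ℕ) (S T : List Z) :
    splits (k + 6) S T = (List.range 27).flatMap fun i =>
      splits k ((block S (3 ^ (k + 3)) i).take (3 ^ k))
        ((block S (3 ^ (k + 3)) i).drop (3 ^ k) ++ T) := rfl

theorem splits_of_lt_six {Z : Type*} {k : ℕ} (hk : k < 6) (S T : List Z) :
    splits k S T = [S ++ T] := by
  interval_cases k <;> rfl

/-- Induction in steps of six. -/
theorem induction_six {P : ℕ → Prop} (h0 : ∀ k < 6, P k) (h1 : ∀ k, P k → P (k + 6)) (k : ℕ) :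
    P k := by
  induction k using Nat.strong_induction_on with
  | _ k ih =>
    by_cases hk : k < 6
    · exact h0 k hk
    · obtain ⟨m, rfl⟩ := Nat.exists_eq_add_of_le' (not_lt.1 hk)
      exact h1 m (ih m (by omega))

theorem map_block {Z W : Type*} (f : Z → W) (S : List Z) (b i : ℕ) :
    block (S.map f) b i = (block S b i).map f := by
  simp [block, List.map_take, List.map_drop]

theorem block_sublist {Z : Type*} (S : List Z) (b i : ℕ) : (block S b i).Sublist S :=
  (List.take_sublist _ _).trans (List.drop_sublist _ _)

/-- Naturality lets the splitting run on a fixed list of indices, with the examples substituted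
afterwards; disjointness of index lists then expresses independence. -/
theorem splits_map {Z W : Type*} (f : Z → W) (k : ℕ) : ∀ S T : List Z,
    splits k (S.map f) (T.map f) = (splits k S T).map (List.map f) := by
  induction k using induction_six with
  | h0 k hk => intro S T; simp [splits_of_lt_six hk]
  | h1 k ih =>
    intro S T
    simp only [splits_add_six, map_block, ← List.map_take, ← List.map_drop, ← List.map_append, ih,
      List.map_flatMap]

theorem length_splits {Z : Type*} (k : ℕ) : ∀ S T : List Z,
    (splits k S T).length = 27 ^ (k / 6) := by
  induction k using induction_six with
  | h0 k hk => intro S T; simp [splits_of_lt_six hk, Nat.div_eq_of_lt hk]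
  | h1 k ih =>
    intro S T
    rw [splits_add_six, List.length_flatMap, show (k + 6) / 6 = k / 6 + 1 by omega]
    simp only [ih]
    rw [List.map_const', List.sum_replicate, List.length_range, smul_eq_mul, pow_succ 27 (k / 6),
      mul_comm]

/-- The first part bounds empirical errors by those on the whole input; the second guarantees that
inactive examples are used by every member of the subfamily. -/
theorem subperm_and_sublist_of_mem_splits {Z : Type*} (k : ℕ) : ∀ {S T L : List Z},
    L ∈ splits k S T → L.Subperm (S ++ T) ∧ T.Sublist L := by
  induction k using induction_six with
  | h0 k hk =>
    intro S T L hL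
    rw [splits_of_lt_six hk, List.mem_singleton] at hL
    subst hL
    exact ⟨List.Subperm.refl _, List.sublist_append_right _ _⟩
  | h1 k ih =>
    intro S T L hL
    rw [splits_add_six] at hL
    obtain ⟨i, -, hi⟩ := List.mem_flatMap.1 hL
    obtain ⟨h1, h2⟩ := ih hi
    refine ⟨h1.trans ?_, (List.sublist_append_right _ _).trans h2⟩
    rw [← List.append_assoc, List.take_append_drop]
    exact ((block_sublist _ _ _).append_right _).subperm

theorem drop_block_sublist_of_mem_splits {Z : Type*} {U V T L : List Z} {k : ℕ}
    (hL : L ∈ splits k U (V ++ T)) : V.Sublist L :=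
  (List.sublist_append_left _ _).trans (subperm_and_sublist_of_mem_splits k hL).2

theorem length_block {Z : Type*} {S : List Z} {b i n : ℕ} (hS : S.length = n * b) (hi : i < n) :
    (block S b i).length = b := by
  have : (i + 1) * b ≤ n * b := Nat.mul_le_mul_right _ hi
  rw [add_mul, one_mul] at this
  simp only [block, List.length_take, List.length_drop]
  omega

theorem disjoint_block {Z : Type*} {S : List Z} (hS : S.Nodup) {b i j : ℕ} (hij : i ≠ j) :
    (block S b i).Disjoint (block S b j) := by
  have key : ∀ {i j}, i < j → (block S b i).Disjoint (block S b j) := by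
    intro i j h
    have h1 : (i + 1) * b ≤ j * b := Nat.mul_le_mul_right _ h
    have h2 : (block S b i).Sublist (S.take ((i + 1) * b)) := by
      rw [block, List.take_drop, add_mul, one_mul]
      exact List.drop_sublist _ _
    have h3 : (block S b j).Sublist (S.drop ((i + 1) * b)) := by
      refine (List.take_sublist _ _).trans ?_
      rw [← Nat.sub_add_cancel h1, add_comm, ← List.drop_drop]
      exact List.drop_sublist _ _
    exact List.disjoint_of_subset_left h2.subset (List.disjoint_of_subset_right h3.subset
      (List.disjoint_take_drop hS le_rfl))
  rcases lt_or_gt_of_ne hij with h | h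
  · exact key h
  · exact (key h).symm

theorem countP_eq_sum_fin {α : Type*} (p : α → Bool) (L : List α) :
    (L.countP p : ℝ) = ∑ i : Fin L.length, if p (L.get i) then (1 : ℝ) else 0 := by
  have h := Fin.sum_univ_fun_getElem L fun a => if p a then (1 : ℝ) else 0
  simp only [List.get_eq_getElem]
  rw [h]
  induction L with
  | nil => simp
  | cons a L ih =>
    have ih' := ih (Fin.sum_univ_fun_getElem L fun a => if p a then (1 : ℝ) else 0)
    rw [List.countP_cons, List.map_cons, List.sum_cons, ← ih']
    push_cast
    ring

theorem avgNe_map_eq_avg {X Y : Type*} (F : List Y) (g : Y → Hypothesis X) (e : Example X) :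
    avgNe (F.map g) e =
      avg fun i : Fin F.length => if g (F.get i) e.1 ≠ e.2 then (1 : ℝ) else 0 := by
  rw [avgNe, avg, List.countP_map, countP_eq_sum_fin, List.length_map, Fintype.card_fin,
    div_eq_inv_mul]
  simp

theorem avgNe_nonneg {X : Type*} (F : List (Hypothesis X)) (e : Example X) : 0 ≤ avgNe F e := by
  unfold avgNe
  positivity

theorem avgNe_le_one {X : Type*} (F : List (Hypothesis X)) (e : Example X) : avgNe F e ≤ 1 := by
  unfold avgNe
  exact div_le_one_of_le₀ (by exact_mod_cast List.countP_le_length) (by positivity)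

theorem ermFamily_map {X I : Type*} (A : Learner X) (k : ℕ) (s t : List I) (z : I → Example X) :
    ermFamily A k (s.map z) (t.map z) = (splits k s t).map fun l => A (l.map z) := by
  rw [ermFamily, splits_map, List.map_map]
  rfl

/-- Equal sizes are essential here: they make the overall fraction the unweighted mean of the
fractions of the subfamilies. -/
theorem avgNe_flatMap_range {X : Type*} (G : ℕ → List (Hypothesis X)) {N : ℕ}
    (hG : ∀ i, (G i).length = N) (n : ℕ) (e : Example X) :
    avgNe ((List.range n).flatMap G) e = (∑ i : Fin n, avgNe (G i) e) / n := by
  have h1 : (((List.range n).flatMap G).countP fun h => decide (h e.1 ≠ e.2)) =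
      ∑ i ∈ Finset.range n, (G i).countP fun h => decide (h e.1 ≠ e.2) := by
    induction n with
    | zero => simp
    | succ n ih =>
      rw [List.range_succ, List.flatMap_append, List.countP_append, ih, Finset.sum_range_succ]
      simp
  have h2 : ((List.range n).flatMap G).length = n * N := by
    rw [List.length_flatMap]
    simp [hG]
  simp only [avgNe, h1, h2, hG]
  rw [Finset.sum_range, ← Finset.sum_div, div_div]
  push_cast
  rw [mul_comm]

theorem length_mul_empiricalError {X : Type*} (S : List (Example X)) (h : Hypothesis X) :
    S.length * empiricalError S h = (S.countP (fun z => decide (h z.1 ≠ z.2)) : ℝ) := by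
  rcases eq_or_ne S [] with rfl | hS
  · simp
  · have : (S.length : ℝ) ≠ 0 := by simpa using hS
    rw [empiricalError, mul_div_cancel₀ _ this]

theorem IsERM.countP_le {X : Type*} {H : Set (Hypothesis X)} {A : Learner X} (hA : IsERM H A)
    {h : Hypothesis X} (hh : h ∈ H) (S : List (Example X)) :
    S.countP (fun z => decide (A S z.1 ≠ z.2)) ≤ S.countP (fun z => decide (h z.1 ≠ z.2)) := by
  have := mul_le_mul_of_nonneg_left ((hA S).2 h hh) (Nat.cast_nonneg (α := ℝ) S.length)
  rw [length_mul_empiricalError, length_mul_empiricalError] at this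
  exact_mod_cast this

variable {X I : Type*} [MeasurableSpace X]

theorem IsMeasurableLearner.measurable_map {A : Learner X} (hA : IsMeasurableLearner A)
    (l : List I) : Measurable fun p : (I → Example X) × X => A (l.map p.1) p.2 := by
  have h1 : Measurable fun p : (I → Example X) × X =>
      ((fun i : Fin l.length => p.1 (l.get i)), p.2) := by fun_prop
  have h2 := (hA l.length).comp h1
  have h3 : ∀ z : I → Example X, List.ofFn (fun i : Fin l.length => z (l.get i)) = l.map z := by
    intro z
    conv_rhs => rw [← List.ofFn_get l, List.map_ofFn]
    rfl
  simpa only [Function.comp_def, h3] using h2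

theorem IsMeasurableLearner.measurableSet_ne {A : Learner X} (hA : IsMeasurableLearner A)
    (l : List I) :
    MeasurableSet {p : (I → Example X) × Example X | A (l.map p.1) p.2.1 ≠ p.2.2} :=
  measurableSet_ne_label ((hA.measurable_map l).comp
    (measurable_fst.prodMk measurable_snd.fst)) measurable_snd.snd

theorem IsMeasurableLearner.measurable_avgNe {A : Learner X} (hA : IsMeasurableLearner A)
    (F : List (List I)) : Measurable fun p : (I → Example X) × Example X =>
      avgNe (F.map fun l => A (l.map p.1)) p.2 := by
  simp only [avgNe_map_eq_avg, avg]
  exact (Finset.measurable_sum _ fun i _ => Measurable.ite (hA.measurableSet_ne _)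
    measurable_const measurable_const).const_mul _

theorem measurable_countP_map [Fintype I] {h : Hypothesis X} (hh : Measurable h) (l : List I) :
    Measurable fun z : I → Example X =>
      ((l.map z).countP (fun e => decide (h e.1 ≠ e.2)) : ℝ) := by
  simp only [List.countP_map, countP_eq_sum_fin]
  refine Finset.measurable_sum _ fun i _ => Measurable.ite ?_ measurable_const measurable_const
  have h1 : Measurable fun z : I → Example X => z (l.get i) := measurable_pi_apply _
  simpa using measurableSet_ne_label (hh.comp h1.fst) h1.snd

end

/-! ### Conditioning on the other examples, and the pairwise decomposition -/

section

/-- If all sections in the coordinates that satisfy `p` have measure at most `c`, so has the set. -/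
theorem measureReal_pi_le_of_sections {I Z : Type*} [Fintype I] [MeasurableSpace Z] (D : Measure Z)
    [IsProbabilityMeasure D] (p : I → Prop) [DecidablePred p] {s : Set (I → Z)}
    (hs : MeasurableSet s) {c : ℝ} (hc : 0 ≤ c)
    (h : ∀ y : {i // ¬p i} → Z, (Measure.pi fun _ : {i // p i} => D).real
      {w | (MeasurableEquiv.piEquivPiSubtypeProd (fun _ => Z) p).symm (w, y) ∈ s} ≤ c) :
    (Measure.pi fun _ : I => D).real s ≤ c := by
  set e := MeasurableEquiv.piEquivPiSubtypeProd (fun _ : I => Z) p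
  have mp := (measurePreserving_piEquivPiSubtypeProd (fun _ : I => D) p).symm
  have hms : MeasurableSet (e.symm ⁻¹' s) := e.symm.measurable hs
  have h1 : (Measure.pi fun _ : I => D) s ≤ ENNReal.ofReal c := by
    rw [← mp.measure_preimage hs.nullMeasurableSet, Measure.prod_apply_symm hms]
    refine (lintegral_mono (g := fun _ => ENNReal.ofReal c) fun y => ?_).trans ?_
    · exact ((ENNReal.le_ofReal_iff_toReal_le (measure_ne_top _ _) hc).2 (h y))
    · simp
  exact ENNReal.toReal_le_of_le_ofReal hc h1

theorem card_errorPattern_le_countP {X I : Type*} {p : I → Prop} [DecidablePred p] [Fintype {i // p i}]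
    {u l : List I} (hu : u.Nodup) (hpu : ∀ i, p i ↔ i ∈ u) (hul : u.Sublist l)
    (R : Set (Example X)) (h : Hypothesis X) (z : I → Example X) :
    (errorPattern R (fun i : {i // p i} => z i) h).card ≤
      (l.map z).countP (fun e => decide (h e.1 ≠ e.2)) := by
  classical
  refine le_trans ?_ ((hul.map z).countP_le)
  rw [List.countP_map, List.countP_eq_length_filter, ← List.toFinset_card_of_nodup (hu.filter _)]
  refine Finset.card_le_card_of_injOn Subtype.val (fun a ha => ?_) Subtype.val_injective.injOn
  have := (mem_errorPattern.1 ha).2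
  simpa [(hpu a.1).1 a.2] using this

variable {X I : Type*} [MeasurableSpace X]

/-- The probability that an example lies in `R` and that a random member of the family errs on
it. -/
noncomputable def jointError (D : Measure (Example X)) (A : Learner X) (F : List (List I))
    (R : Set (Example X)) (z : I → Example X) : ℝ :=
  avg fun i : Fin F.length => D.real (R ∩ {e | A ((F.get i).map z) e.1 ≠ e.2})

/-- Linearity exchanges the average over the family with the integral over the new example. -/
theorem integral_indicator_avgNe (D : Measure (Example X)) [IsProbabilityMeasure D]
    {A : Learner X} (hA : IsMeasurableLearner A) (F : List (List I)) {R : Set (Example X)}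
    (hR : MeasurableSet R) (z : I → Example X) :
    ∫ e, R.indicator (fun e => avgNe (F.map fun l => A (l.map z)) e) e ∂D =
      jointError D A F R z := by
  have hP : ∀ l : List I, MeasurableSet (R ∩ {e : Example X | A (l.map z) e.1 ≠ e.2}) := fun l =>
    hR.inter (measurable_prodMk_left (x := z) (hA.measurableSet_ne l))
  have h1 : ∀ e, R.indicator (fun e => avgNe (F.map fun l => A (l.map z)) e) e =
      avg fun i : Fin F.length =>
        (R ∩ {e | A ((F.get i).map z) e.1 ≠ e.2}).indicator (fun _ => (1 : ℝ)) e := by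
    intro e
    by_cases he : e ∈ R
    · rw [Set.indicator_of_mem he, avgNe_map_eq_avg]
      congr 1
      funext i
      by_cases hi : A ((F.get i).map z) e.1 = e.2 <;> simp_all
    · simp [he, avg]
  simp_rw [h1]
  rw [jointError, avg]
  simp only [avg]
  rw [integral_const_mul, integral_finsetSum _ fun i _ => (integrable_const _).indicator (hP _)]
  congr 1
  refine Finset.sum_congr rfl fun i _ => ?_
  rw [integral_indicator_const _ (hP _)]
  simp

theorem measurable_measureReal_section {α Z : Type*} [MeasurableSpace α] [MeasurableSpace Z]
    (D : Measure Z) [IsProbabilityMeasure D] {s : α → Set Z}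
    (hs : MeasurableSet {p : α × Z | p.2 ∈ s p.1}) : Measurable fun a => D.real (s a) :=
  (measurable_measure_prodMk_left hs).ennreal_toReal

theorem measurable_jointError [Fintype I] (D : Measure (Example X)) [IsProbabilityMeasure D]
    {A : Learner X} (hA : IsMeasurableLearner A) (F : List (List I))
    {R : (I → Example X) → Set (Example X)}
    (hR : MeasurableSet {p : (I → Example X) × Example X | p.2 ∈ R p.1}) :
    Measurable fun z => jointError D A F (R z) z :=
  (Finset.measurable_sum _ fun i _ => measurable_measureReal_section D
    (s := fun z => R z ∩ {e | A ((F.get i).map z) e.1 ≠ e.2})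
    (hR.inter (hA.measurableSet_ne (F.get i)))).const_mul _

/-- The relative deviation bound, conditionally on all coordinates outside of `u`. -/
theorem measureReal_jointError_gt_le [Fintype I] (D : Measure (Example X))
    [IsProbabilityMeasure D] {H : Set (Hypothesis X)} {d : ℕ} (hd : vcDim H ≤ (d : ℕ∞))
    {A : Learner X} (hA : ∀ S, A S ∈ H) (hAm : IsMeasurableLearner A)
    {u : List I} (hu : u.Nodup) (hu0 : u ≠ []) {F : List (List I)} (hF : F ≠ [])
    (huF : ∀ l ∈ F, u.Sublist l) {R : (I → Example X) → Set (Example X)}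
    (hR : MeasurableSet {p : (I → Example X) × Example X | p.2 ∈ R p.1})
    (hRu : ∀ z z' : I → Example X, (∀ i, i ∉ u → z i = z' i) → R z = R z')
    {b : (I → Example X) → ℝ} (hbm : Measurable b)
    (hb : ∀ z, ∀ l ∈ F, ((l.map z).countP (fun e => decide (A (l.map z) e.1 ≠ e.2)) : ℝ) ≤ b z)
    {x : ℝ} (hx0 : 0 < x) (hx1 : x ≤ 1) {δ : ℝ} (hδ0 : 0 < δ) (hδ1 : δ ≤ 1) :
    (Measure.pi fun _ : I => D).real
      {z | 20 * D.real (R z) * x +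
        8 / u.length * (b z + d * Real.log (1 / x) + 2 * Real.log (1 / δ)) <
        jointError D A F (R z) z} ≤ 2 * δ := by
  classical
  have hms : MeasurableSet {z : I → Example X | 20 * D.real (R z) * x +
        8 / u.length * (b z + d * Real.log (1 / x) + 2 * Real.log (1 / δ)) <
        jointError D A F (R z) z} := by
    have h1 := measurable_measureReal_section D hR
    exact measurableSet_lt (by fun_prop) (measurable_jointError D hAm F hR)
  refine measureReal_pi_le_of_sections D (· ∈ u) hms (by positivity) fun y => ?_
  let _ : Fintype {i // i ∈ u} := Subtype.fintype (· ∈ u)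
  set e := MeasurableEquiv.piEquivPiSubtypeProd (fun _ : I => Example X) (· ∈ u)
  have hem : Measurable fun w : {i // i ∈ u} → Example X => e.symm (w, y) :=
    e.symm.measurable.comp measurable_prodMk_right
  have he1 : ∀ w (i : {i // i ∈ u}), e.symm (w, y) i = w i := fun w i => by
    simp [e, MeasurableEquiv.piEquivPiSubtypeProd, Equiv.piEquivPiSubtypeProd, i.2]
  have he2 : ∀ w w' i, i ∉ u → e.symm (w, y) i = e.symm (w', y) i := fun w w' i hi => by
    simp [e, MeasurableEquiv.piEquivPiSubtypeProd, Equiv.piEquivPiSubtypeProd, hi]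
  obtain ⟨z₀⟩ : Nonempty (Example X) := nonempty_of_isProbabilityMeasure D
  -- Once the coordinates outside `u` are frozen at `y`, the region is a fixed set; the filler `z₀`
  -- on `u` is immaterial by `hRu`.
  set R₀ := R (e.symm (fun _ => z₀, y))
  have hR₀ : ∀ w, R (e.symm (w, y)) = R₀ := fun w => hRu _ _ (he2 _ _)
  have hR₀m : MeasurableSet R₀ := measurable_prodMk_left hR
  have hne : Nonempty {i // i ∈ u} := by
    obtain ⟨a, ha⟩ := List.exists_mem_of_ne_nil u hu0
    exact ⟨⟨a, ha⟩⟩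
  have hneF : Nonempty (Fin F.length) := ⟨⟨0, List.length_pos_iff.2 hF⟩⟩
  have hcard : Fintype.card {i // i ∈ u} = u.length := by
    rw [← List.toFinset_card_of_nodup hu]
    exact Fintype.card_of_subtype _ (by simp)
  have hmeas : ∀ i : Fin F.length, Measurable fun p : ({i // i ∈ u} → Example X) × X =>
      A ((F.get i).map (e.symm (p.1, y))) p.2 := fun i =>
    (hAm.measurable_map (F.get i)).comp ((hem.comp measurable_fst).prodMk measurable_snd)
  have := measureReal_relative_deviation_le D hd hR₀m
    (h := fun (i : Fin F.length) w => A ((F.get i).map (e.symm (w, y))))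
    (fun i w => hA _) hmeas hx0 hx1 hδ0 hδ1 (b := fun w => b (e.symm (w, y))) (by
      intro w i
      refine le_trans ?_ (hb _ (F.get i) (List.get_mem _ _))
      have h2 := card_errorPattern_le_countP (p := (· ∈ u)) hu (fun i => Iff.rfl)
        (huF _ (List.get_mem F i)) R₀ (A ((F.get i).map (e.symm (w, y)))) (e.symm (w, y))
      simp only [he1] at h2
      exact_mod_cast h2)
  rw [hcard] at this
  simpa only [Set.mem_ofPred_eq, hR₀, jointError] using this

/-- If the average of 27 numbers in `[0, 1]` is at least `10 / 243`, then some of them is at least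
`10 / 243`, and the sum of the others is at least `1 / 9`. -/
theorem one_le_sum_pairs {a : Fin 27 → ℝ} (h0 : ∀ j, 0 ≤ a j) (h1 : ∀ j, a j ≤ 1)
    (ha : 10 / 243 ≤ (∑ j, a j) / 27) :
    1 ≤ 9 * ∑ j, ∑ l ∈ Finset.univ.erase j, if 10 / 243 ≤ a j then a l else 0 := by
  obtain ⟨j, hj⟩ : ∃ j, 10 / 243 ≤ a j := by
    by_contra! hc
    have := Finset.sum_lt_sum_of_nonempty (s := Finset.univ) Finset.univ_nonempty
      fun j (_ : j ∈ Finset.univ) => hc j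
    simp only [Finset.sum_const, Finset.card_univ, Fintype.card_fin, nsmul_eq_mul] at this
    norm_num at this
    linarith
  -- The total is at least 27 · 10/243 = 10/9, and the selected term is at most 1.
  have h2 := Finset.add_sum_erase Finset.univ a (Finset.mem_univ j)
  have h3 : ∑ l ∈ Finset.univ.erase j, a l ≤
      ∑ j, ∑ l ∈ Finset.univ.erase j, if 10 / 243 ≤ a j then a l else 0 := by
    refine le_trans (le_of_eq ?_) (Finset.single_le_sum
      (f := fun j => ∑ l ∈ Finset.univ.erase j, if 10 / 243 ≤ a j then a l else 0)
      (fun j _ => Finset.sum_nonneg fun l _ => ?_) (Finset.mem_univ j))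
    · simp [hj]
    · split_ifs
      exacts [h0 l, le_rfl]
  have := h1 j
  linarith

/-- The error of a family that is the union of 27 subfamilies of equal size is controlled by the
errors of one subfamily on the region where another one has a large error. -/
theorem fractionError_flatMap_le (D : Measure (Example X)) [IsProbabilityMeasure D]
    {A : Learner X} (hA : IsMeasurableLearner A) (F : ℕ → List (List I)) {N : ℕ}
    (hF : ∀ i, (F i).length = N) (z : I → Example X) :
    fractionError D (10 / 243) (((List.range 27).flatMap F).map fun l => A (l.map z)) ≤
      9 * ∑ j : Fin 27, ∑ l ∈ Finset.univ.erase j, jointError D A (F l)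
        {e | 10 / 243 ≤ avgNe ((F j).map fun l => A (l.map z)) e} z := by
  have hm : ∀ G : List (List I), Measurable fun e : Example X =>
      avgNe (G.map fun l => A (l.map z)) e := by
    intro G
    have := (hA.measurable_avgNe G).comp (measurable_prodMk_left (x := z))
    exact this
  have hRm : ∀ G : List (List I), MeasurableSet
      {e | 10 / 243 ≤ avgNe (G.map fun l => A (l.map z)) e} :=
    fun G => measurableSet_le measurable_const (hm G)
  have hint : ∀ G G' : List (List I), Integrable
      ({e | 10 / 243 ≤ avgNe (G.map fun l => A (l.map z)) e}.indicator
        fun e => avgNe (G'.map fun l => A (l.map z)) e) D := fun G G' =>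
    (integrable_of_measurable_of_bound (hm G') 1 (avgNe_nonneg _) (avgNe_le_one _)).indicator
      (hRm G)
  rw [fractionError, ← integral_indicator_one (hRm _)]
  simp only [← integral_indicator_avgNe D hA _ (hRm _)]
  have e1 : ∀ j : Fin 27, ∑ l ∈ Finset.univ.erase j,
      ∫ e, {e | 10 / 243 ≤ avgNe ((F j).map fun l => A (l.map z)) e}.indicator
        (fun e => avgNe ((F l).map fun l => A (l.map z)) e) e ∂D =
      ∫ e, ∑ l ∈ Finset.univ.erase j,
        {e | 10 / 243 ≤ avgNe ((F j).map fun l => A (l.map z)) e}.indicator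
          (fun e => avgNe ((F l).map fun l => A (l.map z)) e) e ∂D :=
    fun j => (integral_finsetSum _ fun l _ => hint _ _).symm
  have hint2 : ∀ j : Fin 27, Integrable (fun e => ∑ l ∈ Finset.univ.erase j,
        {e | 10 / 243 ≤ avgNe ((F j).map fun l => A (l.map z)) e}.indicator
          (fun e => avgNe ((F l).map fun l => A (l.map z)) e) e) D :=
    fun j => integrable_finsetSum _ fun l _ => hint _ _
  simp only [e1]
  rw [← integral_finsetSum _ fun j _ => hint2 j, ← integral_const_mul]
  refine integral_mono ((integrable_const _).indicator (hRm _))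
    ((integrable_finsetSum _ fun j _ => hint2 j).const_mul _) fun e => ?_
  have h2 := avgNe_flatMap_range (fun i => (F i).map fun l => A (l.map z)) (N := N)
    (fun i => by simp [hF]) 27 e
  simp only [Set.indicator_apply, Set.mem_ofPred_eq, List.map_flatMap, h2]
  split_ifs with h3
  · have := one_le_sum_pairs (a := fun j : Fin 27 => avgNe ((F j).map fun l => A (l.map z)) e)
      (fun j => avgNe_nonneg _ _) (fun j => avgNe_le_one _ _) (by simpa using h3)
    simpa using this
  · refine mul_nonneg (by norm_num) (Finset.sum_nonneg fun j _ => Finset.sum_nonneg fun l _ => ?_)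
    split_ifs
    exacts [avgNe_nonneg _ _, le_rfl]

end

/-! ### The induction over the recursion -/

section

/-- The number of errors of `h` on the subsequence of `z` with indices `l`. -/
noncomputable def errorCount {X I : Type*} (h : Hypothesis X) (z : I → Example X) (l : List I) :
    ℝ :=
  ((l.map z).countP (fun e => decide (h e.1 ≠ e.2)) : ℝ)

theorem errorCount_nonneg {X I : Type*} (h : Hypothesis X) (z : I → Example X) (l : List I) :
    0 ≤ errorCount h z l := Nat.cast_nonneg _

theorem errorCount_le_of_subperm {X I : Type*} (h : Hypothesis X) (z : I → Example X)
    {l l' : List I} (hl : l.Subperm l') : errorCount h z l ≤ errorCount h z l' := by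
  simp only [errorCount, List.countP_map]
  exact Nat.cast_le.2 (hl.countP_le _)

theorem log_le_mul_of_le_two_pow {y : ℝ} {n : ℕ} (hy : 0 < y) (h : y ≤ 2 ^ n) :
    Real.log y ≤ 0.7 * n := by
  have h1 := Real.log_le_log hy h
  rw [Real.log_pow] at h1
  have := Real.log_two_lt_d9
  nlinarith [Nat.cast_nonneg (α := ℝ) n]

/-- The recursion for the constant in the error bound. -/
theorem add_le_of_bounds {E d δ M q p : ℝ} (hE : 0 ≤ E) (hd : 0 ≤ d) (hδ0 : 0 < δ) (hδ1 : δ < 1)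
    (hM : 0 < M) (hq : q ≤ 10 ^ 9 * (E + d + Real.log (Real.exp 1 / (δ / 54))) / M)
    (hp : p ≤ 20 * q * (1 / 10 ^ 10) +
      8 / (26 * M) * (E + d * Real.log (1 / (1 / 10 ^ 10)) + 2 * Real.log (1 / (δ / 2808)))) :
    p ≤ 40 * (E + d + Real.log (Real.exp 1 / δ)) / M := by
  have e1 : Real.log (Real.exp 1 / (δ / 54)) = Real.log (Real.exp 1 / δ) + Real.log 54 := by
    rw [← Real.log_mul (by positivity) (by norm_num)]
    congr 1
    field_simp
  have e2 : Real.log (1 / (δ / 2808)) = Real.log (1 / δ) + Real.log 2808 := by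
    rw [← Real.log_mul (by positivity) (by norm_num)]
    congr 1
    field_simp
  have e3 : Real.log (Real.exp 1 / δ) = 1 + Real.log (1 / δ) := by
    rw [div_eq_mul_one_div, Real.log_mul (by positivity) (by positivity), Real.log_exp]
  have e4 : 0 ≤ Real.log (1 / δ) := Real.log_nonneg (by rw [le_div_iff₀ hδ0]; linarith)
  -- Crude logarithms suffice: the hypotheses give coefficients below 3 for `E`, 11 for `d` and 3
  -- for `log (1 / δ)`, and an additive constant below 16, all within 40.
  have h54 := log_le_mul_of_le_two_pow (y := 54) (n := 6) (by norm_num) (by norm_num)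
  have h2808 := log_le_mul_of_le_two_pow (y := 2808) (n := 12) (by norm_num) (by norm_num)
  have hx := log_le_mul_of_le_two_pow (y := 1 / (1 / 10 ^ 10)) (n := 40)
    (by norm_num) (by norm_num)
  rw [e1, e3] at hq
  rw [e2] at hp
  rw [e3]
  set ℓ := Real.log (1 / δ)
  push_cast at h54 h2808 hx
  rw [le_div_iff₀ hM] at hq ⊢
  have h8 : 8 / (26 * M) * (E + d * Real.log (1 / (1 / 10 ^ 10)) + 2 * (ℓ + Real.log 2808)) * M =
      8 / 26 * (E + d * Real.log (1 / (1 / 10 ^ 10)) + 2 * (ℓ + Real.log 2808)) := by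
    field_simp
  have hp' := mul_le_mul_of_nonneg_right hp hM.le
  rw [add_mul, h8] at hp'
  have hdx := mul_le_mul_of_nonneg_left hx hd
  nlinarith

/-- This is the independence used in the induction: a region built from one block and `t` ignores
the inactive examples of another block. -/
theorem map_splits_congr {X I : Type*} {s t u : List I} (hsu : ∀ i ∈ s ++ t, i ∉ u) {k : ℕ} (A : Learner X)
    {z z' : I → Example X} (h : ∀ i, i ∉ u → z i = z' i) :
    ((splits k s t).map fun l => A (l.map z)) = (splits k s t).map fun l => A (l.map z') := by
  refine List.map_congr_left fun l hl => ?_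
  congr 1
  refine List.map_congr_left fun i hi => h i (hsu i ?_)
  exact (subperm_and_sublist_of_mem_splits k hl).1.subset hi

theorem errorCount_finRange {X : Type*} {n : ℕ} (h : Hypothesis X) (z : Fin n → Example X) :
    errorCount h z (List.finRange n) = hits {e | h e.1 ≠ e.2} z := by
  classical
  rw [errorCount, hits, List.countP_map, List.countP_eq_length_filter,
    ← List.toFinset_card_of_nodup ((List.nodup_finRange n).filter _)]
  congr 2
  ext i
  simp

variable {X I : Type*} [MeasurableSpace X] [Fintype I]

/-- The high-probability error bound for the splitting algorithm on sequences of length `3 ^ k`,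
in terms of the number of errors of `hstar` on the input sequences. -/
def SplitBound (I : Type*) [Fintype I] (D : Measure (Example X)) (A : Learner X)
    (hstar : Hypothesis X) (d k : ℕ) : Prop :=
  ∀ s t : List I, (s ++ t).Nodup → s.length = 3 ^ k → ∀ δ : ℝ, 0 < δ → δ < 1 →
    (Measure.pi fun _ : I => D).real
      {z | 10 ^ 9 * (errorCount hstar z (s ++ t) + d + Real.log (Real.exp 1 / δ)) / 3 ^ k <
        fractionError D (10 / 243) ((splits k s t).map fun l => A (l.map z))} ≤ δ

/-- The claimed bound is at least 1, since `3 ^ k ≤ 10 ^ 9` and `log (e / δ) ≥ 1`. -/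
theorem splitBound_of_lt_six (D : Measure (Example X)) [IsProbabilityMeasure D] (A : Learner X)
    (hstar : Hypothesis X) (d : ℕ) {k : ℕ} (hk : k < 6) : SplitBound I D A hstar d k := by
  intro s t _ _ δ hδ0 hδ1
  suffices h : {z | 10 ^ 9 * (errorCount hstar z (s ++ t) + d + Real.log (Real.exp 1 / δ)) / 3 ^ k <
      fractionError D (10 / 243) ((splits k s t).map fun l => A (l.map z))} = ∅ by
    rw [h, measureReal_empty]
    exact hδ0.le
  refine Set.eq_empty_of_forall_notMem fun z hz => ?_
  have hz' : 10 ^ 9 * (errorCount hstar z (s ++ t) + d + Real.log (Real.exp 1 / δ)) / 3 ^ k <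
      fractionError D (10 / 243) ((splits k s t).map fun l => A (l.map z)) := hz
  refine absurd (hz'.trans_le measureReal_le_one) (not_lt.2 ?_)
  have h1 : (3 : ℝ) ^ k ≤ 10 ^ 9 :=
    (pow_le_pow_right₀ (by norm_num) hk.le).trans (by norm_num)
  have h2 : 1 ≤ Real.log (Real.exp 1 / δ) := by
    rw [Real.le_log_iff_exp_le (by positivity), le_div_iff₀ hδ0]
    nlinarith [Real.exp_pos 1]
  have h3 := errorCount_nonneg hstar z (s ++ t)
  rw [le_div_iff₀ (by positivity)]
  nlinarith [Nat.cast_nonneg (α := ℝ) d]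

theorem SplitBound.add_six (D : Measure (Example X)) [IsProbabilityMeasure D]
    {H : Set (Hypothesis X)} {d : ℕ} (hd : vcDim H ≤ (d : ℕ∞)) (hH : ∀ h ∈ H, Measurable h)
    {A : Learner X} (hA : IsERM H A) (hAm : IsMeasurableLearner A) {hstar : Hypothesis X}
    (hstar_mem : hstar ∈ H) {k : ℕ} (ih : SplitBound I D A hstar d k) :
    SplitBound I D A hstar d (k + 6) := by
  intro s t hst hs δ hδ0 hδ1
  set B : ℕ → List I := fun j => block s (3 ^ (k + 3)) j
  set U : ℕ → List I := fun j => (B j).take (3 ^ k)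
  set V : ℕ → List I := fun j => (B j).drop (3 ^ k)
  set F : ℕ → List (List I) := fun j => splits k (U j) (V j ++ t)
  have hsB : s.length = 27 * 3 ^ (k + 3) := by rw [hs]; ring
  have hB : ∀ j : Fin 27, (B j).length = 27 * 3 ^ k := fun j => by
    rw [length_block hsB j.2]; ring
  have hU : ∀ j : Fin 27, (U j).length = 3 ^ k := fun j => by
    simp only [U, List.length_take, hB]; omega
  have hV : ∀ j : Fin 27, (V j).length = 26 * 3 ^ k := fun j => by
    simp only [V, List.length_drop, hB]; omega
  have hUV : ∀ j, U j ++ (V j ++ t) = B j ++ t := fun j => by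
    rw [← List.append_assoc, List.take_append_drop]
  have hsub : ∀ j, (U j ++ (V j ++ t)).Sublist (s ++ t) := fun j => by
    rw [hUV]
    exact (block_sublist _ _ _).append_right _
  have hVB : ∀ j, (V j).Sublist (B j) := fun j => List.drop_sublist _ _
  have hVs : ∀ j, (V j).Sublist s := fun j => (hVB j).trans (block_sublist _ _ _)
  have hdisj : ∀ j l : ℕ, j ≠ l → ∀ i ∈ U j ++ (V j ++ t), i ∉ V l := by
    intro j l hjl i hi hil
    rw [hUV, List.mem_append] at hi
    rcases hi with hi | hi
    · exact disjoint_block (List.nodup_append.1 hst).1 hjl hi ((hVB l).subset hil)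
    · exact (List.nodup_append.1 hst).2.2 _ ((hVs l).subset hil) _ hi rfl
  set R : ℕ → (I → Example X) → Set (Example X) := fun j z =>
    {e | 10 / 243 ≤ avgNe ((F j).map fun l => A (l.map z)) e}
  set μ := Measure.pi fun _ : I => D
  set P : ℕ → Set (I → Example X) := fun j =>
    {z | 10 ^ 9 * (errorCount hstar z (U j ++ (V j ++ t)) + d +
      Real.log (Real.exp 1 / (δ / 54))) / 3 ^ k < D.real (R j z)}
  -- Half of `δ` is shared by the 27 regions, at `δ / 54` each. The other half goes to the 27 · 26 =
  -- 702 ordered pairs, at `2 * (δ / 2808) = δ / 1404` each.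
  have hP : ∀ j : Fin 27, μ.real (P j) ≤ δ / 54 := fun j =>
    ih (U j) (V j ++ t) (hst.sublist (hsub j)) (hU j) (δ / 54) (by linarith) (by linarith)
  -- The choice `x = 1 / 10 ^ 10` reduces the inductive constant `10 ^ 9` to 20 · 10⁹ · 10⁻¹⁰ = 2.
  set Q : ℕ → ℕ → Set (I → Example X) := fun j l =>
    {z | 20 * D.real (R j z) * (1 / 10 ^ 10) +
        8 / (V l).length * (errorCount hstar z (s ++ t) + d * Real.log (1 / (1 / 10 ^ 10)) +
          2 * Real.log (1 / (δ / 2808))) < jointError D A (F l) (R j z) z}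
  have hQ : ∀ j l : Fin 27, j ≠ l → μ.real (Q j l) ≤ 2 * (δ / 2808) := by
    intro j l hjl
    refine measureReal_jointError_gt_le D hd (fun S => (hA S).1) hAm
      ((List.nodup_append.1 hst).1.sublist (hVs l)) ?_ ?_
      (fun l' hl' => drop_block_sublist_of_mem_splits hl')
      (measurableSet_le measurable_const (hAm.measurable_avgNe (F j))) ?_
      (measurable_countP_map (hH _ hstar_mem) (s ++ t)) ?_ (by norm_num) (by norm_num)
      (by linarith) (by linarith)
    · rw [← List.length_pos_iff, hV]
      positivity
    · rw [← List.length_pos_iff, length_splits]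
      positivity
    · intro z z' hz
      simp only [R, F]
      rw [map_splits_congr (hdisj j l (fun h => hjl (Fin.ext h))) A hz]
    · intro z l' hl'
      refine (Nat.cast_le.2 (hA.countP_le hstar_mem (l'.map z))).trans ?_
      exact errorCount_le_of_subperm hstar z
        ((subperm_and_sublist_of_mem_splits k hl').1.trans (hsub l).subperm)
  have hbad : {z | 10 ^ 9 * (errorCount hstar z (s ++ t) + d + Real.log (Real.exp 1 / δ)) /
      3 ^ (k + 6) < fractionError D (10 / 243)
        ((splits (k + 6) s t).map fun l => A (l.map z))} ⊆
      (⋃ j ∈ (Finset.univ : Finset (Fin 27)), P j) ∪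
        ⋃ j ∈ (Finset.univ : Finset (Fin 27)), ⋃ l ∈ Finset.univ.erase j, Q j l := by
    intro z hz
    by_contra hc
    simp only [Set.mem_union, Set.mem_iUnion, not_or, not_exists, Finset.mem_univ,
      Finset.mem_erase, and_true, forall_const, ne_eq] at hc
    obtain ⟨hcP, hcQ⟩ := hc
    have hE := errorCount_nonneg hstar z (s ++ t)
    set L := errorCount hstar z (s ++ t) + d + Real.log (Real.exp 1 / δ)
    have hp : ∀ j : Fin 27, ∀ l ∈ Finset.univ.erase j,
        jointError D A (F l) (R j z) z ≤ 40 * L / 3 ^ k := by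
      intro j l hl
      have h1 : D.real (R j z) ≤ 10 ^ 9 * (errorCount hstar z (U j ++ (V j ++ t)) + d +
          Real.log (Real.exp 1 / (δ / 54))) / 3 ^ k := not_lt.1 (hcP j)
      have h2 : jointError D A (F l) (R j z) z ≤ 20 * D.real (R j z) * (1 / 10 ^ 10) +
        8 / (V l).length * (errorCount hstar z (s ++ t) + d * Real.log (1 / (1 / 10 ^ 10)) +
          2 * Real.log (1 / (δ / 2808))) := not_lt.1 (hcQ j l (Finset.ne_of_mem_erase hl))
      rw [hV] at h2
      push_cast at h2
      refine add_le_of_bounds hE (Nat.cast_nonneg d) hδ0 hδ1 (by positivity) (h1.trans ?_) h2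
      have := errorCount_le_of_subperm hstar z (hsub j).subperm
      gcongr
    have hz' : 10 ^ 9 * L / 3 ^ (k + 6) < fractionError D (10 / 243)
        ((splits (k + 6) s t).map fun l => A (l.map z)) := hz
    refine absurd hz' (not_lt.2 ?_)
    rw [splits_add_six]
    refine (fractionError_flatMap_le D hAm F (fun i => length_splits k _ _) z).trans ?_
    have h3 : ∑ j : Fin 27, ∑ l ∈ Finset.univ.erase j, jointError D A (F l) (R j z) z ≤
        ∑ j : Fin 27, ∑ l ∈ Finset.univ.erase j, 40 * L / 3 ^ k :=
      Finset.sum_le_sum fun j _ => Finset.sum_le_sum fun l hl => hp j l hl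
    refine (mul_le_mul_of_nonneg_left h3 (by norm_num)).trans ?_
    simp only [Finset.sum_const, Finset.card_erase_of_mem (Finset.mem_univ _), Finset.card_univ,
      Fintype.card_fin, nsmul_eq_mul]
    have hL : 0 ≤ L := by
      have : 0 ≤ Real.log (Real.exp 1 / δ) := Real.log_nonneg (by
        rw [le_div_iff₀ hδ0]; nlinarith [Real.add_one_le_exp 1])
      positivity
    have hL' : 0 ≤ L / 3 ^ k := by positivity
    -- The induction closes because 9 · 27 · 26 · 40 = 252720 is below 10⁹ / 729, which exceeds 1.3
    -- · 10⁶.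
    have e : (10 : ℝ) ^ 9 * L / 3 ^ (k + 6) = 10 ^ 9 / 729 * (L / 3 ^ k) := by
      rw [pow_add]; field_simp; norm_num
    rw [e, mul_div_assoc]
    norm_num
    nlinarith
  refine (measureReal_mono hbad).trans ((measureReal_union_le _ _).trans ?_)
  have h1 : μ.real (⋃ j ∈ (Finset.univ : Finset (Fin 27)), P j) ≤ δ / 2 := by
    refine (measureReal_biUnion_finset_le _ _).trans
      ((Finset.sum_le_sum fun j _ => hP j).trans (le_of_eq ?_))
    simp only [Finset.sum_const, Finset.card_univ, Fintype.card_fin, nsmul_eq_mul]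
    push_cast
    ring
  have h2 : μ.real (⋃ j ∈ (Finset.univ : Finset (Fin 27)), ⋃ l ∈ Finset.univ.erase j, Q j l) ≤
      δ / 2 := by
    refine (measureReal_biUnion_finset_le _ _).trans
      ((Finset.sum_le_sum fun j _ => (measureReal_biUnion_finset_le _ _).trans
        (Finset.sum_le_sum fun l hl => hQ j l (Finset.ne_of_mem_erase hl).symm)).trans
        (le_of_eq ?_))
    simp only [Finset.sum_const, Finset.card_erase_of_mem (Finset.mem_univ _), Finset.card_univ,
      Fintype.card_fin, nsmul_eq_mul]
    push_cast
    ring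
  linarith

theorem splitBound (D : Measure (Example X)) [IsProbabilityMeasure D]
    {H : Set (Hypothesis X)} {d : ℕ} (hd : vcDim H ≤ (d : ℕ∞)) (hH : ∀ h ∈ H, Measurable h)
    {A : Learner X} (hA : IsERM H A) (hAm : IsMeasurableLearner A) {hstar : Hypothesis X}
    (hstar_mem : hstar ∈ H) (k : ℕ) : SplitBound I D A hstar d k := by
  induction k using induction_six with
  | h0 k hk => exact splitBound_of_lt_six D A hstar d hk
  | h1 k ih => exact SplitBound.add_six D hd hH hA hAm hstar_mem ih

end

end AgnosticERM

/-! ### From empirical errors of `hstar` to its true error -/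

open AgnosticERM
theorem mainTheorem5 :
    ∃ c : ℝ, 1 ≤ c ∧
      ∀ (X : Type*) [MeasurableSpace X]
        (H : Set (Hypothesis X)) (_hH : ∀ h ∈ H, Measurable h)
        (d : ℕ) (_hd : vcDim H = (d : ℕ∞))
        (A : Learner X) (_hA : IsERM H A) (_hAm : IsMeasurableLearner A)
        (D : Measure (Example X)) [IsProbabilityMeasure D]
        (hstar : Hypothesis X) (_hstar_mem : hstar ∈ H)
        (_hstar_min : ∀ h ∈ H, trueError D hstar ≤ trueError D h)
        (δ : ℝ) (_hδ0 : 0 < δ) (_hδ1 : δ < 1)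
        (k m : ℕ) (_hk : 6 ≤ k) (_hm : m = 3 ^ k),
        1 - δ ≤ (Measure.pi (fun _ : Fin m => D)).real
          {S : Fin m → Example X |
            fractionError D (10 / 243) (ermFamily A k (List.ofFn S) []) ≤
              c * trueError D hstar
                + c * ((d : ℝ) + Real.log (Real.exp 1 / δ)) / (m : ℝ)} := by
  -- The Chernoff bound adds `2 * τ * m + log (2 / δ)` to `d + log (2 * e / δ)`. The sum is at most
  -- `4 * (τ * m + d + log (e / δ))`, because `1 + 2 * log 2 ≤ 4`.
  refine ⟨4 * 10 ^ 9, by norm_num, ?_⟩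
  intro X _ H hH d hd A hA hAm D _ hstar hstar_mem _ δ hδ0 hδ1 k m _ hm
  have hm0 : (0 : ℝ) < m := by rw [hm]; positivity
  set μ := Measure.pi fun _ : Fin m => D
  set W₁ := {z : Fin m → Example X | 10 ^ 9 * (errorCount hstar z (List.finRange m ++ []) + d +
    Real.log (Real.exp 1 / (δ / 2))) / 3 ^ k < fractionError D (10 / 243)
      ((splits k (List.finRange m) []).map fun l => A (l.map z))}
  have h1 : μ.real W₁ ≤ δ / 2 := splitBound D hd.le hH hA hAm hstar_mem k (List.finRange m) []
    (by simpa using List.nodup_finRange m) (by simpa using hm) (δ / 2) (by linarith) (by linarith)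
  -- `W₁` is the failure of the splitting bound and `W₂` an excess of errors of `hstar`; each
  -- receives `δ / 2`.
  set W₂ := {z : Fin m → Example X | 2 * trueError D hstar * Fintype.card (Fin m) +
    Real.log (1 / (δ / 2)) < hits {e | hstar e.1 ≠ e.2} z}
  have h2 : μ.real W₂ ≤ δ / 2 := measureReal_hits_gt_le D
    (measurableSet_ne_label ((hH _ hstar_mem).comp measurable_fst) measurable_snd) (by linarith)
  set G := {S : Fin m → Example X |
    fractionError D (10 / 243) (ermFamily A k (List.ofFn S) []) ≤
      4 * 10 ^ 9 * trueError D hstar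
        + 4 * 10 ^ 9 * ((d : ℝ) + Real.log (Real.exp 1 / δ)) / (m : ℝ)}
  have hcover : (Set.univ : Set (Fin m → Example X)) ⊆ G ∪ (W₁ ∪ W₂) := by
    intro S _
    by_contra hc
    rw [Set.mem_union, Set.mem_union, not_or, not_or] at hc
    obtain ⟨hcG, hc1, hc2⟩ := hc
    have h3 : fractionError D (10 / 243)
        ((splits k (List.finRange m) []).map fun l => A (l.map S)) ≤
        10 ^ 9 * (errorCount hstar S (List.finRange m ++ []) + d +
          Real.log (Real.exp 1 / (δ / 2))) / 3 ^ k := not_lt.1 hc1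
    have h4 : hits {e | hstar e.1 ≠ e.2} S ≤ 2 * trueError D hstar * Fintype.card (Fin m) +
        Real.log (1 / (δ / 2)) := not_lt.1 hc2
    refine hcG ?_
    change fractionError D (10 / 243) (ermFamily A k (List.ofFn S) []) ≤
      4 * 10 ^ 9 * trueError D hstar
        + 4 * 10 ^ 9 * ((d : ℝ) + Real.log (Real.exp 1 / δ)) / (m : ℝ)
    rw [List.append_nil, errorCount_finRange, ← ermFamily_map, List.map_nil,
      ← List.ofFn_eq_map, show (3 : ℝ) ^ k = m by rw [hm]; push_cast; rfl] at h3
    rw [Fintype.card_fin] at h4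
    refine h3.trans ?_
    have e1 : Real.log (Real.exp 1 / (δ / 2)) = 1 + Real.log 2 + Real.log (1 / δ) := by
      rw [show Real.exp 1 / (δ / 2) = Real.exp 1 * 2 * (1 / δ) by field_simp,
        Real.log_mul (by positivity) (by positivity), Real.log_mul (by positivity) (by norm_num),
        Real.log_exp]
    have e2 : Real.log (1 / (δ / 2)) = Real.log 2 + Real.log (1 / δ) := by
      rw [show 1 / (δ / 2) = 2 * (1 / δ) by field_simp,
        Real.log_mul (by norm_num) (by positivity)]
    have e3 : Real.log (Real.exp 1 / δ) = 1 + Real.log (1 / δ) := by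
      rw [div_eq_mul_one_div, Real.log_mul (by positivity) (by positivity), Real.log_exp]
    have e4 : 0 ≤ Real.log (1 / δ) := Real.log_nonneg (by rw [le_div_iff₀ hδ0]; linarith)
    have e5 := Real.log_two_lt_d9
    have e6 : 0 ≤ trueError D hstar * m := mul_nonneg measureReal_nonneg hm0.le
    rw [e1, e3, div_le_iff₀ hm0, add_mul, div_mul_cancel₀ _ hm0.ne']
    rw [e2] at h4
    nlinarith [Nat.cast_nonneg (α := ℝ) d]
  have h5 := (measureReal_mono (μ := μ) hcover).trans (measureReal_union_le _ _)
  have h6 := measureReal_union_le (μ := μ) W₁ W₂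
  rw [probReal_univ] at h5
  linarith
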